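/- Let $k$ be a field of characteristic zero and let $(\wedge V,d)$ be a simply connected Sullivan algebra over $k$: $V=\bigoplus_{i\ge 2}V^i$ is a graded vector space, $\wedge V$ is the free graded commutative algebra on $V$, $d$ is a derivation of degree $1$ with $d^2=0$, and $V$ is the union of graded subspaces $V(0)\subset V(1)\subset\cdots$ with $d=0$ on $V(0)$ and $d(V(j+1))\subset\wedge V(j)$ for all $j\ge 0$. Suppose that $H^*(\wedge V)$ satisfies Poincaré duality in dimension $m$: it is finite dimensional, $\dim H^m(\wedge V)=1$, and the pairings $H^i(\wedge V)\otimes H^{m-i}(\wedge V)\to H^m(\wedge V)$ given by the product are non-degenerate. A fundamental class is a nonzero element $\omega\in H^m(\wedge V)$. Let $\overline V$ be the graded vector space with $\overline V^{\,i}=V^{i+1}$, write $\bar v$ for the element of $\overline V$ that corresponds to $v\in V$, and let $\mathcal L=\wedge V\otimes\wedge\overline V$. Let $s$ be the derivation of $\mathcal L$ of degree $-1$ with $sv=\bar v$ and $s\bar v=0$ for $v \in V$, and let $d$ be the differential of $\mathcal L$ that is a derivation, extends that of $\wedge V$ and satisfies $ds+sd=0$. Put $\mathcal L_{(j)}=\wedge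 V\otimes\wedge^j\overline V$, so that $\mathcal L=\bigoplus_j\mathcal L_{(j)}$ as complexes and $H(\wedge V)=H(\mathcal L_{(0)})\subset H(\mathcal L)$. For a differential graded algebra $A$ let $\operatorname{Der}(A)$ be the complex whose part $\operatorname{Der}^p(A)$, $p\in\mathbb Z$, is the space of derivations of $A$ of degree $p$, with the differential $\theta\mapsto[d,\theta]=d\theta-(-1)^{p}\theta d$. For $\theta\in\operatorname{Der}^p(\wedge V)$ let $e_\theta\in\operatorname{Der}^{p+1}(\mathcal L)$ be the derivation with $e_\theta v=0$ and $e_\theta\bar v=(-1)^p\theta v$ for $v\in V$. Then $[d,e_\theta]=-e_{[d,\theta]}$, so a cocycle $\theta$ induces a derivation $H(e_\theta)$ of $H(\mathcal L)$ that depends only on $[\theta]$. The following hold. 1. Let $\omega\in H^m(\wedge V)$ be a fundamental class. For every $n\in\mathbb Z$ and every $[\theta]\ne 0$ in $H^{-n-1}(\operatorname{Der}(\wedge V))$ there is a class $[\alpha]\in H^{m+n}(\mathcal L_{(1)})$ such that $H(e_\theta)[\alpha]=\omega$ in $H^m(\wedge V)\subset H^m(\mathcal L)$. 2. For every $p\in\mathbb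 Z$ the map $H^p(\operatorname{Der}(\wedge V))\to\operatorname{Der}^{p+1}(H(\mathcal L))$, $[\theta]\mapsto H(e_\theta)$, is injective, and hence so is the map $H^p(e)\colon H^p(\operatorname{Der}(\wedge V))\to H^{p+1}(\operatorname{Der}(\mathcal L))$, $[\theta]\mapsto[e_\theta]$. -/

import Mathlib

open scoped DirectSum

set_option maxSynthPendingDepth 3

noncomputable section

namespace SullivanLoop

universe u v

/-! ### Koszul signs -/

/-- The sign `(-1)^n` as a scalar of `k`, for an integer `n`. -/
def sgn (k : Type u) [Field k] (n : ℤ) : k := ((n.negOnePow : ℤ) : k)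

section Sign

variable {k : Type u} [Field k]

theorem sgn_add (m n : ℤ) : sgn k (m + n) = sgn k m * sgn k n := by
  simp [sgn, Int.negOnePow_add]

theorem sgn_neg (n : ℤ) : sgn k (-n) = sgn k n := by
  simp [sgn]

@[simp] theorem sgn_zero : sgn k 0 = 1 := by simp [sgn]

@[simp] theorem sgn_one : sgn k 1 = -1 := by simp [sgn]

theorem sgn_sub (m n : ℤ) : sgn k (m - n) = sgn k m * sgn k n := by
  rw [sub_eq_add_neg, sgn_add, sgn_neg]

@[simp] theorem sgn_mul_self (n : ℤ) : sgn k n * sgn k n = 1 := by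
  rw [← sgn_add, ← two_mul]
  simp [sgn]

@[simp] theorem sgn_sq (n : ℤ) : sgn k n ^ 2 = 1 := by rw [pow_two, sgn_mul_self]

end Sign

/-! ### Graded derivations -/

section Derivation

variable {k : Type u} [Field k] {A : Type v} [Ring A] [Algebra k A]

/-- `Der 𝒜 p` is the space of derivations of degree `p` of the graded algebra `A` with
homogeneous parts `𝒜 i`: the linear maps `θ` with `θ (𝒜 i) ⊆ 𝒜 (i + p)` and
`θ (a b) = θ a * b + (-1)^(p |a|) a * θ b`. -/
def Der (𝒜 : ℤ → Submodule k A) (p : ℤ) : Submodule k (A →ₗ[k] A) where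
  carrier := {θ | (∀ i, ∀ a ∈ 𝒜 i, θ a ∈ 𝒜 (i + p)) ∧
    ∀ i, ∀ a ∈ 𝒜 i, ∀ b, θ (a * b) = θ a * b + sgn k (p * i) • (a * θ b)}
  add_mem' := by
    rintro θ η ⟨h1, h2⟩ ⟨h3, h4⟩
    refine ⟨fun i a ha => add_mem (h1 i a ha) (h3 i a ha), fun i a ha b => ?_⟩
    simp only [LinearMap.add_apply, h2 i a ha, h4 i a ha, add_mul, mul_add, smul_add]
    abel
  zero_mem' := ⟨fun i a _ => zero_mem _, fun i a _ b => by simp⟩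
  smul_mem' := by
    rintro c θ ⟨h1, h2⟩
    refine ⟨fun i a ha => Submodule.smul_mem _ _ (h1 i a ha), fun i a ha b => ?_⟩
    simp only [LinearMap.smul_apply, h2 i a ha, smul_add, smul_mul_assoc, mul_smul_comm]
    rw [smul_comm]

variable {𝒜 : ℤ → Submodule k A}

theorem Der.bracket_mem {p q : ℤ} {θ η : A →ₗ[k] A} (hθ : θ ∈ Der 𝒜 p) (hη : η ∈ Der 𝒜 q) :
    θ ∘ₗ η - sgn k (p * q) • (η ∘ₗ θ) ∈ Der 𝒜 (p + q) := by
  refine ⟨fun i a ha => ?_, fun i a ha b => ?_⟩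
  · refine sub_mem ?_ (Submodule.smul_mem _ _ ?_)
    · have := hθ.1 _ _ (hη.1 _ _ ha)
      rwa [add_assoc, add_comm q p] at this
    · have := hη.1 _ _ (hθ.1 _ _ ha)
      rwa [add_assoc] at this
  · simp only [LinearMap.sub_apply, LinearMap.comp_apply, LinearMap.smul_apply,
      hη.2 i a ha, hθ.2 i a ha, map_add, map_smul, hθ.2 _ _ (hη.1 _ _ ha),
      hη.2 _ _ (hθ.1 _ _ ha), smul_add, smul_sub, sub_mul, mul_sub, smul_mul_assoc,
      mul_smul_comm, smul_smul, mul_add, add_mul, sgn_add]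
    have e1 : sgn k (p * q) * (sgn k (q * i) * sgn k (q * p)) = sgn k (q * i) := by
      rw [mul_comm q p, mul_left_comm, sgn_mul_self, mul_one]
    have e2 : sgn k (q * i) * sgn k (p * i) = sgn k (p * i) * sgn k (q * i) := mul_comm _ _
    have e3 : sgn k (p * q) * (sgn k (p * i) * sgn k (q * i)) =
      sgn k (p * i) * sgn k (q * i) * sgn k (p * q) := by ring
    rw [e1, e2, e3, mul_comm (sgn k (p * q)) (sgn k (p * i))]
    module

theorem Der.comp_self_mem {p : ℤ} (hp : sgn k (p * p) = -1) {θ : A →ₗ[k] A}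
    (hθ : θ ∈ Der 𝒜 p) : θ ∘ₗ θ ∈ Der 𝒜 (p + p) := by
  refine ⟨fun i a ha => ?_, fun i a ha b => ?_⟩
  · rw [← add_assoc]
    exact hθ.1 _ _ (hθ.1 _ _ ha)
  · simp only [LinearMap.comp_apply, hθ.2 i a ha, map_add, map_smul, hθ.2 _ _ (hθ.1 _ _ ha),
      mul_add, add_mul, sgn_add, hp, smul_add, smul_smul]
    module

theorem Der.map_one [SetLike.GradedOne 𝒜] {p : ℤ} {θ : A →ₗ[k] A} (hθ : θ ∈ Der 𝒜 p) :
    θ 1 = 0 := by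
  have := hθ.2 0 1 SetLike.GradedOne.one_mem 1
  simpa using this

end Derivation

/-! ### Free graded commutative algebras -/

section Free

variable (k : Type u) [Field k] {ι : Type} (deg : ι → ℤ)
  (V : ι → Type v) [∀ i, AddCommGroup (V i)] [∀ i, Module k (V i)]

/-- The relations of the free graded commutative algebra: the generators `v ∈ V i` depend
linearly on `v`, and `v w = (-1)^(|v| |w|) w v`. -/
inductive FreeGCA.Rel : FreeAlgebra k (Σ i, V i) → FreeAlgebra k (Σ i, V i) → Prop
  | add (i : ι) (v w : V i) : FreeGCA.Rel (FreeAlgebra.ι k ⟨i, v + w⟩)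
      (FreeAlgebra.ι k ⟨i, v⟩ + FreeAlgebra.ι k ⟨i, w⟩)
  | smul (i : ι) (c : k) (v : V i) : FreeGCA.Rel (FreeAlgebra.ι k ⟨i, c • v⟩)
      (c • FreeAlgebra.ι k ⟨i, v⟩)
  | comm (i j : ι) (v : V i) (w : V j) :
      FreeGCA.Rel (FreeAlgebra.ι k ⟨i, v⟩ * FreeAlgebra.ι k ⟨j, w⟩)
      (sgn k (deg i * deg j) • (FreeAlgebra.ι k ⟨j, w⟩ * FreeAlgebra.ι k ⟨i, v⟩))

/-- The free graded commutative algebra `∧ V` on the graded vector space `⨁ i, V i`, where `V i`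
is placed in degree `deg i` (over a field of characteristic zero). -/
def FreeGCA : Type (max u v) := RingQuot (FreeGCA.Rel k deg V)

namespace FreeGCA

instance : Ring (FreeGCA k deg V) := inferInstanceAs (Ring (RingQuot (FreeGCA.Rel k deg V)))

instance : Algebra k (FreeGCA k deg V) :=
  inferInstanceAs (Algebra k (RingQuot (FreeGCA.Rel k deg V)))

/-- The quotient map from the free algebra. -/
def mk : FreeAlgebra k (Σ i, V i) →ₐ[k] FreeGCA k deg V :=
  RingQuot.mkAlgHom k (FreeGCA.Rel k deg V)

variable {k deg V} in
theorem mk_rel {x y : FreeAlgebra k (Σ i, V i)} (h : Rel k deg V x y) :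
    mk k deg V x = mk k deg V y :=
  RingQuot.mkAlgHom_rel k h

theorem mk_surjective : Function.Surjective (mk k deg V) :=
  RingQuot.mkAlgHom_surjective k (FreeGCA.Rel k deg V)

/-- The inclusion of the generators `V i → ∧ V`. -/
def gen (i : ι) : V i →ₗ[k] FreeGCA k deg V where
  toFun v := mk k deg V (FreeAlgebra.ι k ⟨i, v⟩)
  map_add' v w := by
    rw [← map_add]
    exact mk_rel (Rel.add i v w)
  map_smul' c v := by
    rw [RingHom.id_apply, ← map_smul]
    exact mk_rel (Rel.smul i c v)

variable {k deg V}

theorem gen_mul_gen (i j : ι) (v : V i) (w : V j) :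
    gen k deg V i v * gen k deg V j w =
      sgn k (deg i * deg j) • (gen k deg V j w * gen k deg V i v) := by
  have : mk k deg V _ = mk k deg V _ := mk_rel (Rel.comm i j v w)
  rw [map_mul, map_smul, map_mul] at this
  exact this

section Lift

variable {B : Type*} [Semiring B] [Algebra k B] (f : ∀ i, V i →ₗ[k] B)
  (hf : ∀ i j v w, f i v * f j w = sgn k (deg i * deg j) • (f j w * f i v))

/-- The universal property of the free graded commutative algebra. -/
def lift : FreeGCA k deg V →ₐ[k] B :=
  RingQuot.liftAlgHom k ⟨FreeAlgebra.lift k (fun x : Σ i, V i => f x.1 x.2), by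
    intro x y h
    cases h with
    | add i v w => simp
    | smul i c v => simp
    | comm i j v w => simpa using hf i j v w⟩

@[simp] theorem lift_gen (i : ι) (v : V i) : lift f hf (gen k deg V i v) = f i v := by
  have := RingQuot.liftAlgHom_mkAlgHom_apply k (FreeAlgebra.lift k (fun x : Σ i, V i => f x.1 x.2))
    (s := FreeGCA.Rel k deg V) (by
      intro x y h
      cases h with
      | add i v w => simp
      | smul i c v => simp
      | comm i j v w => simpa using hf i j v w) (FreeAlgebra.ι k ⟨i, v⟩)
  rw [FreeAlgebra.lift_ι_apply] at this
  exact this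

end Lift

/-- Induction over products of generators. -/
theorem induction {P : FreeGCA k deg V → Prop} (one : P 1)
    (gen_mul : ∀ i v x, P x → P (gen k deg V i v * x))
    (add : ∀ x y, P x → P y → P (x + y)) (smul : ∀ (c : k) x, P x → P (c • x)) (x) : P x := by
  suffices h : ∀ a : FreeAlgebra k (Σ i, V i), ∀ y, P y →
      P (mk k deg V a * y) by
    obtain ⟨a, rfl⟩ := mk_surjective k deg V x
    simpa using h a 1 one
  intro a
  induction a using FreeAlgebra.induction with
  | grade0 r =>
    intro y hy
    rw [AlgHom.commutes, ← Algebra.smul_def]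
    exact smul r y hy
  | grade1 x =>
    intro y hy
    exact gen_mul x.1 x.2 y hy
  | mul a b ha hb =>
    intro y hy
    rw [map_mul, mul_assoc]
    exact ha _ (hb _ hy)
  | add a b ha hb =>
    intro y hy
    rw [map_add, add_mul]
    exact add _ _ (ha _ hy) (hb _ hy)

theorem algHom_ext {B : Type*} [Semiring B] [Algebra k B] {f g : FreeGCA k deg V →ₐ[k] B}
    (h : ∀ i v, f (gen k deg V i v) = g (gen k deg V i v)) : f = g := by
  ext x
  induction x using induction with
  | one => simp
  | gen_mul i v x hx => rw [map_mul, map_mul, h, hx]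
  | add x y hx hy => rw [map_add, map_add, hx, hy]
  | smul c x hx => rw [map_smul, map_smul, hx]

/-! #### Gradings -/

section Grading

variable {M : Type} [AddCommMonoid M] (g : ι → M)

variable (k deg V) in
/-- `IsMonomial g m x`: the element `x` is a product of generators, of total weight `m`
when the generators in `V i` get the weight `g i`. -/
inductive IsMonomial : M → FreeGCA k deg V → Prop
  | one : IsMonomial 0 1
  | gen_mul (i : ι) (v : V i) (m : M) (x : FreeGCA k deg V) :
      IsMonomial m x → IsMonomial (g i + m) (gen k deg V i v * x)

variable (k deg V) in
/-- The part of weight `m` of `∧ V`, spanned by the products of generators of total weight `m`,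
when the generators in `V i` get the weight `g i`. -/
def part (m : M) : Submodule k (FreeGCA k deg V) :=
  Submodule.span k {x | IsMonomial k deg V g m x}

variable {g}

theorem one_mem_part : (1 : FreeGCA k deg V) ∈ part k deg V g 0 :=
  Submodule.subset_span IsMonomial.one

theorem gen_mul_mem_part (i : ι) (v : V i) {m : M} {x : FreeGCA k deg V}
    (hx : x ∈ part k deg V g m) : gen k deg V i v * x ∈ part k deg V g (g i + m) := by
  induction hx using Submodule.span_induction with
  | mem x hx => exact Submodule.subset_span (IsMonomial.gen_mul i v m x hx)
  | zero => simp
  | add x y _ _ hx hy => rw [mul_add]; exact add_mem hx hy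
  | smul c x _ hx => rw [mul_smul_comm]; exact Submodule.smul_mem _ _ hx

theorem gen_mem_part (i : ι) (v : V i) : gen k deg V i v ∈ part k deg V g (g i) := by
  simpa using gen_mul_mem_part (g := g) i v (one_mem_part (k := k) (deg := deg) (V := V))

/-- Induction over the monomials of a given weight. -/
theorem part_induction {P : M → FreeGCA k deg V → Prop} (one : P 0 1)
    (gen_mul : ∀ i v m x, x ∈ part k deg V g m → P m x → P (g i + m) (gen k deg V i v * x))
    (zero : ∀ m, P m 0)
    (add : ∀ m x y, P m x → P m y → P m (x + y))
    (smul : ∀ m (c : k) x, P m x → P m (c • x)) {m : M} {x : FreeGCA k deg V}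
    (hx : x ∈ part k deg V g m) : P m x := by
  induction hx using Submodule.span_induction with
  | mem x hx =>
    induction hx with
    | one => exact one
    | gen_mul i v m x h ih => exact gen_mul i v m x (Submodule.subset_span h) ih
  | zero => exact zero m
  | add x y _ _ hx hy => exact add m x y hx hy
  | smul c x _ hx => exact smul m c x hx

instance : SetLike.GradedMonoid (part k deg V g) where
  one_mem := one_mem_part
  mul_mem := by
    intro m n x y hx hy
    refine part_induction (P := fun m x => x * y ∈ part k deg V g (m + n)) ?_ ?_ ?_ ?_ ?_ hx
    · simpa using hy
    · intro i v m x _ hx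
      rw [mul_assoc, add_assoc]
      exact gen_mul_mem_part i v hx
    · intro m
      simp
    · intro m x x' hx hx'
      rw [add_mul]
      exact add_mem hx hx'
    · intro m c x hx
      rw [smul_mul_assoc]
      exact Submodule.smul_mem _ _ hx

variable [DecidableEq M]

variable (k deg V g) in
/-- The decomposition of a generator. -/
def decomposeGen (i : ι) : V i →ₗ[k] ⨁ m, part k deg V g m :=
  (DirectSum.lof k M (fun m => part k deg V g m) (g i)) ∘ₗ
    (gen k deg V i).codRestrict (part k deg V g (g i)) (fun v => gen_mem_part i v)

theorem decomposeGen_apply (i : ι) (v : V i) : decomposeGen k deg V g i v =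
    DirectSum.of (fun m => part k deg V g m) (g i) ⟨gen k deg V i v, gen_mem_part i v⟩ := rfl

theorem decomposeGen_comm (i j : ι) (v : V i) (w : V j) :
    decomposeGen k deg V g i v * decomposeGen k deg V g j w =
      sgn k (deg i * deg j) • (decomposeGen k deg V g j w * decomposeGen k deg V g i v) := by
  simp only [decomposeGen_apply, DirectSum.of_mul_of]
  rw [← DirectSum.lof_eq_of k, ← DirectSum.lof_eq_of k, ← map_smul, DirectSum.lof_eq_of k,
    DirectSum.lof_eq_of k]
  apply DirectSum.of_eq_of_gradedMonoid_eq
  exact Sigma.subtype_ext (add_comm _ _) (gen_mul_gen i j v w)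

variable (k deg V g) in
/-- The decomposition of `∧ V` into the parts of the various weights. -/
def decomposeHom : FreeGCA k deg V →ₐ[k] ⨁ m, part k deg V g m :=
  lift (decomposeGen k deg V g) decomposeGen_comm

theorem decomposeHom_apply {m : M} {x : FreeGCA k deg V} (hx : x ∈ part k deg V g m) :
    decomposeHom k deg V g x = DirectSum.of (fun m => part k deg V g m) m ⟨x, hx⟩ := by
  suffices h : ∃ hx : x ∈ part k deg V g m,
      decomposeHom k deg V g x = DirectSum.of (fun m => part k deg V g m) m ⟨x, hx⟩ from h.2
  refine part_induction (P := fun m x => ∃ hx : x ∈ part k deg V g m,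
      decomposeHom k deg V g x = DirectSum.of (fun m => part k deg V g m) m ⟨x, hx⟩)
      ?_ ?_ ?_ ?_ ?_ hx
  · exact ⟨one_mem_part, map_one _⟩
  · rintro i v m x _ ⟨hx, h⟩
    refine ⟨gen_mul_mem_part i v hx, ?_⟩
    rw [map_mul, h, decomposeHom, lift_gen, decomposeGen_apply, DirectSum.of_mul_of]
    rfl
  · intro m
    exact ⟨zero_mem _, (map_zero _).trans (map_zero _).symm⟩
  · rintro m x y ⟨hx, h⟩ ⟨hy, h'⟩
    exact ⟨add_mem hx hy, by rw [map_add, h, h', ← map_add]; rfl⟩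
  · rintro m c x ⟨hx, h⟩
    exact ⟨Submodule.smul_mem _ c hx, by
      rw [map_smul, h, ← DirectSum.lof_eq_of k, ← map_smul]; rfl⟩

instance : GradedAlgebra (part k deg V g) :=
  GradedAlgebra.ofAlgHom _ (decomposeHom k deg V g)
    (by
      apply algHom_ext
      intro i v
      rw [AlgHom.comp_apply, decomposeHom_apply (gen_mem_part i v), DirectSum.coeAlgHom_of]
      rfl)
    (fun m x => decomposeHom_apply x.2)

end Grading

/-! #### Derivations of free graded commutative algebras -/

theorem gen_mul_comm (i : ι) (v : V i) {n : ℤ} {x : FreeGCA k deg V}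
    (hx : x ∈ part k deg V deg n) :
    gen k deg V i v * x = sgn k (deg i * n) • (x * gen k deg V i v) := by
  refine part_induction (P := fun n x =>
    gen k deg V i v * x = sgn k (deg i * n) • (x * gen k deg V i v)) ?_ ?_ ?_ ?_ ?_ hx
  · simp
  · intro j w n x _ ih
    rw [← mul_assoc, gen_mul_gen, smul_mul_assoc, mul_assoc, ih, mul_smul_comm, smul_smul,
      ← sgn_add, mul_add, mul_assoc]
  · simp
  · intro n x y hx hy
    rw [mul_add, hx, hy, add_mul, smul_add]
  · intro n c x hx
    rw [mul_smul_comm, hx, smul_mul_assoc, smul_comm]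

/-- Derivations that agree on the generators are equal. -/
theorem der_ext {p : ℤ} {θ η : FreeGCA k deg V →ₗ[k] FreeGCA k deg V}
    (hθ : θ ∈ Der (part k deg V deg) p) (hη : η ∈ Der (part k deg V deg) p)
    (h : ∀ i v, θ (gen k deg V i v) = η (gen k deg V i v)) : θ = η := by
  ext x
  induction x using induction with
  | one => rw [Der.map_one hθ, Der.map_one hη]
  | gen_mul i v x hx =>
    rw [hθ.2 _ _ (gen_mem_part i v), hη.2 _ _ (gen_mem_part i v), h, hx]
  | add x y hx hy => rw [map_add, map_add, hx, hy]
  | smul c x hx => rw [map_smul, map_smul, hx]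

section Extend

variable (p : ℤ) (f : ∀ i, V i →ₗ[k] FreeGCA k deg V)

/-- The generators of the algebra homomorphism `a ↦ ((±a, θ a), (0, a))` attached to a
derivation `θ` with given values on the generators. -/
def extendGen (i : ι) : V i →ₗ[k] Matrix (Fin 2) (Fin 2) (FreeGCA k deg V) where
  toFun v := !![sgn k (p * deg i) • gen k deg V i v, f i v; 0, gen k deg V i v]
  map_add' v w := by
    ext a b
    fin_cases a <;> fin_cases b <;> simp
  map_smul' c v := by
    ext a b
    fin_cases a <;> fin_cases b <;> simp [smul_comm c]

theorem extendGen_comm (hf : ∀ i v, f i v ∈ part k deg V deg (deg i + p)) (i j : ι) (v : V i) (w : V j) :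
    extendGen p f i v * extendGen p f j w =
      sgn k (deg i * deg j) • (extendGen p f j w * extendGen p f i v) := by
  have h1 := gen_mul_comm i v (hf j w)
  have h2 := gen_mul_comm j w (hf i v)
  have h3 := gen_mul_gen (deg := deg) (k := k) i j v w
  have h4 : f i v * gen k deg V j w = sgn k (deg j * (deg i + p)) • (gen k deg V j w * f i v) := by
    rw [h2, smul_smul, sgn_mul_self, one_smul]
  ext a b
  fin_cases a <;> fin_cases b
  · simp only [extendGen, LinearMap.coe_mk, AddHom.coe_mk]
    simp [Matrix.mul_apply, h3, smul_smul]
    ring_nf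
  · simp only [extendGen, LinearMap.coe_mk, AddHom.coe_mk]
    simp [Matrix.mul_apply, h1, h4, smul_smul, mul_add, sgn_add, mul_comm (deg j) p,
      mul_comm (deg i) p, mul_comm (deg j) (deg i)]
    rw [mul_left_comm, sgn_mul_self, mul_one, add_comm]
  · simp [extendGen, Matrix.mul_apply]
  · simp [extendGen, Matrix.mul_apply, h3]

variable (hf : ∀ i v, f i v ∈ part k deg V deg (deg i + p))

/-- The algebra homomorphism `a ↦ ((±a, θ a), (0, a))` attached to a derivation `θ`. -/
def extendHom : FreeGCA k deg V →ₐ[k] Matrix (Fin 2) (Fin 2) (FreeGCA k deg V) :=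
  lift (extendGen p f) (extendGen_comm p f hf)

theorem extendHom_gen (i : ι) (v : V i) :
    extendHom p f hf (gen k deg V i v) = extendGen p f i v := lift_gen _ _ i v

/-- The derivation of degree `p` with given values `f` on the generators. -/
def extend : FreeGCA k deg V →ₗ[k] FreeGCA k deg V where
  toFun a := extendHom p f hf a 0 1
  map_add' a b := by rw [map_add]; rfl
  map_smul' c a := by rw [map_smul]; rfl

theorem extend_gen (i : ι) (v : V i) : extend p f hf (gen k deg V i v) = f i v := by
  change extendHom p f hf _ 0 1 = _
  rw [extendHom_gen]
  rfl

theorem extendHom_row (a : FreeGCA k deg V) :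
    extendHom p f hf a 1 0 = 0 ∧ extendHom p f hf a 1 1 = a := by
  induction a using induction with
  | one => simp
  | gen_mul i v x hx =>
    rw [map_mul, extendHom_gen, Matrix.mul_apply, Matrix.mul_apply]
    simp [extendGen, hx]
  | add x y hx hy => simp [map_add, hx, hy]
  | smul c x hx => simp [map_smul, hx]

theorem extendHom_diag {i : ℤ} {a : FreeGCA k deg V} (ha : a ∈ part k deg V deg i) :
    extendHom p f hf a 0 0 = sgn k (p * i) • a := by
  refine part_induction (P := fun i a => extendHom p f hf a 0 0 = sgn k (p * i) • a)
    ?_ ?_ ?_ ?_ ?_ ha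
  · simp
  · intro i v m x _ hx
    rw [map_mul, extendHom_gen, Matrix.mul_apply]
    simp [extendGen, hx, (extendHom_row p f hf x).1, mul_add, sgn_add, smul_smul, mul_comm]
  · simp
  · intro m x y hx hy
    simp [map_add, hx, hy]
  · intro m c x hx
    simp [map_smul, hx, smul_comm c]

theorem extend_mul {i : ℤ} {a : FreeGCA k deg V} (ha : a ∈ part k deg V deg i)
    (b : FreeGCA k deg V) : extend p f hf (a * b) =
      extend p f hf a * b + sgn k (p * i) • (a * extend p f hf b) := by
  change extendHom p f hf (a * b) 0 1 = _
  rw [map_mul, Matrix.mul_apply, Fin.sum_univ_two, extendHom_diag p f hf ha,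
    (extendHom_row p f hf b).2, add_comm, smul_mul_assoc]
  rfl

theorem extend_mem : extend p f hf ∈ Der (part k deg V deg) p := by
  refine ⟨fun i a ha => ?_, fun i a ha b => extend_mul p f hf ha b⟩
  refine part_induction (P := fun i a => extend p f hf a ∈ part k deg V deg (i + p))
    ?_ ?_ ?_ ?_ ?_ ha
  · have h := extend_mul p f hf (one_mem_part (k := k) (deg := deg) (V := V)) 1
    rw [mul_zero, sgn_zero, one_smul, mul_one, mul_one, one_mul, left_eq_add] at h
    rw [h]
    exact zero_mem _
  · intro i v m x hx' hx
    rw [extend_mul p f hf (gen_mem_part i v), extend_gen]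
    refine add_mem ?_ (Submodule.smul_mem _ _ ?_)
    · have := SetLike.mul_mem_graded (hf i v) hx'
      rwa [add_right_comm] at this
    · rw [add_assoc]
      exact gen_mul_mem_part i v hx
  · simp
  · intro m x y hx hy
    rw [map_add]
    exact add_mem hx hy
  · intro m c x hx
    rw [map_smul]
    exact Submodule.smul_mem _ _ hx

end Extend

end FreeGCA

end Free

/-! ### Differential graded algebras and their cohomology -/

/-- A differential on the graded algebra `A` with homogeneous parts `𝒜 i`: a derivation of
degree `1` and square zero. -/
structure DGStructure {k : Type u} [Field k] {A : Type v} [Ring A] [Algebra k A]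
    (𝒜 : ℤ → Submodule k A) where
  d : A →ₗ[k] A
  d_mem : d ∈ Der 𝒜 1
  d_d : ∀ a, d (d a) = 0

namespace DGStructure

variable {k : Type u} [Field k] {A : Type v} [Ring A] [Algebra k A]
  {𝒜 : ℤ → Submodule k A}

/-! #### The complex of derivations -/

variable (D : DGStructure 𝒜)

/-- The differential `θ ↦ [d, θ] = d θ - (-1)^p θ d` on the linear maps of degree `p`. -/
def endDiff (p : ℤ) : (A →ₗ[k] A) →ₗ[k] (A →ₗ[k] A) where
  toFun θ := D.d ∘ₗ θ - sgn k p • (θ ∘ₗ D.d)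
  map_add' θ η := by
    ext a
    simp only [LinearMap.sub_apply, LinearMap.comp_apply, LinearMap.add_apply, map_add,
      LinearMap.smul_apply, smul_add]
    abel
  map_smul' c θ := by
    ext a
    simp [smul_sub, smul_comm c]

theorem endDiff_apply (p : ℤ) (θ : A →ₗ[k] A) (a : A) :
    D.endDiff p θ a = D.d (θ a) - sgn k p • θ (D.d a) := rfl

theorem endDiff_mem {p : ℤ} {θ : A →ₗ[k] A} (hθ : θ ∈ Der 𝒜 p) :
    D.endDiff p θ ∈ Der 𝒜 (p + 1) := by
  have := Der.bracket_mem D.d_mem hθ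
  rwa [one_mul, add_comm] at this

theorem endDiff_endDiff (p : ℤ) (θ : A →ₗ[k] A) : D.endDiff (p + 1) (D.endDiff p θ) = 0 := by
  ext a
  simp [endDiff_apply, D.d_d, sgn_add]

/-- The cocycles of degree `p` of the complex `Der(A)` with the differential `[d, -]`. -/
def derCocycles (p : ℤ) : Submodule k (A →ₗ[k] A) := Der 𝒜 p ⊓ LinearMap.ker (D.endDiff p)

/-- The coboundaries of degree `p` of the complex `Der(A)` with the differential `[d, -]`. -/
def derCoboundaries (p : ℤ) : Submodule k (A →ₗ[k] A) := (Der 𝒜 (p - 1)).map (D.endDiff (p - 1))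

theorem mem_derCocycles {p : ℤ} {θ : A →ₗ[k] A} :
    θ ∈ D.derCocycles p ↔ θ ∈ Der 𝒜 p ∧ D.endDiff p θ = 0 := Iff.rfl

theorem derCocycles_le (p : ℤ) : D.derCocycles p ≤ Der 𝒜 p := inf_le_left

theorem derCoboundaries_le (p : ℤ) : D.derCoboundaries p ≤ D.derCocycles p := by
  rintro _ ⟨θ, hθ, rfl⟩
  refine ⟨?_, ?_⟩
  · simpa using D.endDiff_mem hθ
  · simpa using D.endDiff_endDiff (p - 1) θ

/-- The cohomology `H^p(Der(A))` of the complex of derivations. -/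
abbrev DerCohomology (p : ℤ) : Type v :=
  D.derCocycles p ⧸ (D.derCoboundaries p).submoduleOf (D.derCocycles p)

theorem derCocycles_comm {p : ℤ} {θ : A →ₗ[k] A} (hθ : θ ∈ D.derCocycles p) (a : A) :
    D.d (θ a) = sgn k p • θ (D.d a) :=
  sub_eq_zero.1 (LinearMap.congr_fun (LinearMap.mem_ker.1 hθ.2) a)

/-! #### The cohomology algebra -/

variable [GradedAlgebra 𝒜]

variable (𝒜) in
/-- The sign involution `a ↦ (-1)^|a| a`. -/
def signMap : A →ₗ[k] A :=
  (DirectSum.toModule k ℤ A fun i => sgn k i • (𝒜 i).subtype) ∘ₗ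
    (DirectSum.decomposeLinearEquiv 𝒜).toLinearMap

theorem signMap_of_mem {i : ℤ} {a : A} (ha : a ∈ 𝒜 i) : signMap 𝒜 a = sgn k i • a := by
  simp only [signMap, LinearMap.comp_apply, LinearEquiv.coe_coe,
    DirectSum.decomposeLinearEquiv_apply, DirectSum.decompose_of_mem 𝒜 ha]
  rw [← DirectSum.lof_eq_of k, DirectSum.toModule_lof]
  rfl

theorem d_signMap (a : A) : D.d (signMap 𝒜 a) = - signMap 𝒜 (D.d a) := by
  induction a using DirectSum.Decomposition.inductionOn 𝒜 with
  | zero => simp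
  | @homogeneous i a =>
    rw [signMap_of_mem a.2, signMap_of_mem (D.d_mem.1 _ _ a.2), map_smul, sgn_add]
    simp
  | add a b ha hb => rw [map_add, map_add, ha, hb, map_add, map_add, neg_add]

theorem d_mul_of_right {b : A} (hb : D.d b = 0) (a : A) : D.d (a * b) = D.d a * b := by
  induction a using DirectSum.Decomposition.inductionOn 𝒜 with
  | zero => simp
  | @homogeneous i a => rw [D.d_mem.2 _ _ a.2, hb, mul_zero, smul_zero, add_zero]
  | add a a' ha ha' => rw [add_mul, map_add, ha, ha', map_add, add_mul]

theorem d_signMap_mul (b a : A) :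
    D.d (signMap 𝒜 b * a) = D.d (signMap 𝒜 b) * a + b * D.d a := by
  induction b using DirectSum.Decomposition.inductionOn 𝒜 with
  | zero => simp
  | @homogeneous i b =>
    rw [signMap_of_mem b.2, smul_mul_assoc, map_smul, map_smul, D.d_mem.2 _ _ b.2, smul_add,
      smul_smul, one_mul, sgn_mul_self, one_smul, smul_mul_assoc]
  | add b b' hb hb' =>
    rw [map_add, add_mul, map_add, hb, hb', map_add, add_mul, add_mul]
    abel

/-- The subalgebra of cocycles. -/
def cocycles : Subalgebra k A where
  carrier := {a | D.d a = 0}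
  mul_mem' {a b} ha hb := by
    change D.d (a * b) = 0
    rw [D.d_mul_of_right hb, show D.d a = 0 from ha, zero_mul]
  add_mem' {a b} ha hb := by
    change D.d (a + b) = 0
    rw [map_add, show D.d a = 0 from ha, show D.d b = 0 from hb, add_zero]
  algebraMap_mem' c := by
    change D.d (algebraMap k A c) = 0
    rw [Algebra.algebraMap_eq_smul_one, map_smul, Der.map_one D.d_mem, smul_zero]

theorem mem_cocycles {a : A} : a ∈ D.cocycles ↔ D.d a = 0 := Iff.rfl

/-- The ideal of coboundaries in the algebra of cocycles. -/
def coboundaries : Ideal D.cocycles where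
  carrier := {z | ∃ a, D.d a = z}
  add_mem' := by
    rintro x y ⟨a, ha⟩ ⟨b, hb⟩
    exact ⟨a + b, by rw [map_add, ha, hb]; rfl⟩
  zero_mem' := ⟨0, map_zero _⟩
  smul_mem' := by
    rintro z x ⟨a, ha⟩
    refine ⟨signMap 𝒜 z * a, ?_⟩
    rw [d_signMap_mul, d_signMap, D.mem_cocycles.1 z.2, ha]
    simp

theorem mem_coboundaries {z : D.cocycles} : z ∈ D.coboundaries ↔ ∃ a, D.d a = z := Iff.rfl

instance : D.coboundaries.IsTwoSided where
  mul_mem_of_left := by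
    rintro x z ⟨a, ha⟩
    exact ⟨a * z, by rw [D.d_mul_of_right z.2, ha]; rfl⟩

/-- The cohomology algebra `H(A) = ker d / im d`. -/
abbrev Cohomology : Type v := D.cocycles ⧸ D.coboundaries

/-- The class of a cocycle. -/
def cls : D.cocycles →ₗ[k] D.Cohomology := (Ideal.Quotient.mkₐ k D.coboundaries).toLinearMap

theorem cls_surjective : Function.Surjective D.cls := Ideal.Quotient.mk_surjective

theorem cls_mul (x y : D.cocycles) : D.cls (x * y) = D.cls x * D.cls y :=
  map_mul (Ideal.Quotient.mkₐ k D.coboundaries) x y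

theorem cls_eq_zero {x : D.cocycles} (hx : x ∈ D.coboundaries) : D.cls x = 0 :=
  Ideal.Quotient.eq_zero_iff_mem.2 hx

/-- The subspace of `H(A)` of the classes that are represented by a cocycle in `S ⊆ A`. -/
def classesOf (S : Submodule k A) : Submodule k D.Cohomology :=
  (S.comap D.cocycles.val.toLinearMap).map D.cls

/-- The cohomology `H^i(A)` in degree `i`, as a subspace of `H(A)`. -/
def cohomologyPart (i : ℤ) : Submodule k D.Cohomology := D.classesOf (𝒜 i)

/-- The linear map `H(A) → H(A')` induced by a linear map `A → A'` that preserves cocycles and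
coboundaries. -/
def mapCohomology {A' : Type v} [Ring A'] [Algebra k A'] {𝒜' : ℤ → Submodule k A'}
    [GradedAlgebra 𝒜'] (D' : DGStructure 𝒜') (F : A →ₗ[k] A')
    (hz : ∀ a, D.d a = 0 → D'.d (F a) = 0) (hb : ∀ a, ∃ a', D'.d a' = F (D.d a)) :
    D.Cohomology →ₗ[k] D'.Cohomology :=
  ((D.coboundaries.restrictScalars k).liftQ
    (D'.cls ∘ₗ (F ∘ₗ D.cocycles.val.toLinearMap).codRestrict
      (Subalgebra.toSubmodule D'.cocycles) (fun z => hz _ z.2)) (by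
    rintro z ⟨a, ha⟩
    obtain ⟨a', ha'⟩ := hb a
    exact D'.cls_eq_zero ⟨a', by rw [ha', ha]; rfl⟩)) ∘ₗ
  (Submodule.Quotient.restrictScalarsEquiv k D.coboundaries).symm.toLinearMap

theorem mapCohomology_cls {A' : Type v} [Ring A'] [Algebra k A'] {𝒜' : ℤ → Submodule k A'}
    [GradedAlgebra 𝒜'] (D' : DGStructure 𝒜') (F : A →ₗ[k] A')
    (hz : ∀ a, D.d a = 0 → D'.d (F a) = 0) (hb : ∀ a, ∃ a', D'.d a' = F (D.d a))
    (z : D.cocycles) :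
    D.mapCohomology D' F hz hb (D.cls z) = D'.cls ⟨F z, hz _ z.2⟩ := rfl

/-- The map `H(θ) : H(A) → H(A)` induced by a cocycle `θ` of `Der(A)`. -/
def inducedEnd {p : ℤ} (θ : D.derCocycles p) : D.Cohomology →ₗ[k] D.Cohomology :=
  D.mapCohomology D θ.1
    (fun a ha => by rw [D.derCocycles_comm θ.2, ha, map_zero, smul_zero])
    (fun a => ⟨sgn k p • θ.1 a, by
      rw [map_smul, D.derCocycles_comm θ.2, smul_smul, sgn_mul_self, one_smul]⟩)

theorem inducedEnd_mem {p : ℤ} (θ : D.derCocycles p) :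
    D.inducedEnd θ ∈ Der D.cohomologyPart p := by
  refine ⟨?_, ?_⟩
  · rintro i _ ⟨z, hz, rfl⟩
    exact ⟨⟨θ.1 z, _⟩, θ.2.1.1 i _ hz, rfl⟩
  · rintro i _ ⟨z, hz, rfl⟩ b
    obtain ⟨w, rfl⟩ := D.cls_surjective b
    rw [← cls_mul, inducedEnd, mapCohomology_cls, mapCohomology_cls, mapCohomology_cls,
      ← cls_mul, ← cls_mul, ← map_smul, ← map_add]
    congr 1
    exact Subtype.ext (θ.2.1.2 i _ hz w)

theorem inducedEnd_cls {p : ℤ} (θ : D.derCocycles p) (z : D.cocycles) {w : A}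
    (hw : w = θ.1 z) (hw' : w ∈ D.cocycles) : D.inducedEnd θ (D.cls z) = D.cls ⟨w, hw'⟩ := by
  subst hw
  rfl

theorem inducedEnd_cocycle {p : ℤ} (θ : D.derCocycles p) (z : D.cocycles) :
    θ.1 z ∈ D.cocycles := by
  rw [mem_cocycles, D.derCocycles_comm θ.2, D.mem_cocycles.1 z.2, map_zero, smul_zero]

/-- The map `θ ↦ H(θ)` on the cocycles of `Der(A)`. -/
def inducedDerCocycle (p : ℤ) : D.derCocycles p →ₗ[k] Der D.cohomologyPart p :=
  LinearMap.codRestrict _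
    { toFun := D.inducedEnd
      map_add' := fun θ η => by
        refine LinearMap.ext fun x => ?_
        obtain ⟨z, rfl⟩ := D.cls_surjective x
        rw [LinearMap.add_apply, D.inducedEnd_cls θ z rfl (D.inducedEnd_cocycle θ z),
          D.inducedEnd_cls η z rfl (D.inducedEnd_cocycle η z), ← map_add]
        exact D.inducedEnd_cls (θ + η) z rfl _
      map_smul' := fun c θ => by
        refine LinearMap.ext fun x => ?_
        obtain ⟨z, rfl⟩ := D.cls_surjective x
        rw [RingHom.id_apply, LinearMap.smul_apply,
          D.inducedEnd_cls θ z rfl (D.inducedEnd_cocycle θ z), ← map_smul]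
        exact D.inducedEnd_cls (c • θ) z rfl _ }
    D.inducedEnd_mem

theorem inducedDerCocycle_coboundary (p : ℤ) :
    (D.derCoboundaries p).submoduleOf (D.derCocycles p) ≤
      LinearMap.ker (D.inducedDerCocycle p) := by
  rintro ⟨θ, hθ⟩ ⟨η, hη, h⟩
  rw [LinearMap.mem_ker]
  refine Subtype.ext (LinearMap.ext fun x => ?_)
  obtain ⟨z, rfl⟩ := D.cls_surjective x
  have h' : D.d (η z) - sgn k (p - 1) • η (D.d z) = θ z := LinearMap.congr_fun h z
  rw [D.mem_cocycles.1 z.2, map_zero, smul_zero, sub_zero] at h'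
  exact (D.inducedEnd_cls ⟨θ, hθ⟩ z rfl (D.inducedEnd_cocycle ⟨θ, hθ⟩ z)).trans
    (D.cls_eq_zero ⟨η z, h'⟩)

/-- The map `H^p(Der(A)) → Der^p(H(A))`, `[θ] ↦ H(θ)`. -/
def inducedDer (p : ℤ) : D.DerCohomology p →ₗ[k] Der D.cohomologyPart p :=
  ((D.derCoboundaries p).submoduleOf (D.derCocycles p)).liftQ (D.inducedDerCocycle p)
    (D.inducedDerCocycle_coboundary p)

/-- Poincaré duality in dimension `m` for the graded algebra `H(A)`: it is finite dimensional,
`H^m(A)` is one-dimensional, and the pairings `H^i(A) ⊗ H^(m-i)(A) → H^m(A)` given by the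
multiplication are non-degenerate. -/
structure PoincareDuality (m : ℤ) : Prop where
  finite : Module.Finite k D.Cohomology
  finrank_top : Module.finrank k (D.cohomologyPart m) = 1
  nondegenerate_left : ∀ i, ∀ x ∈ D.cohomologyPart i,
    (∀ y ∈ D.cohomologyPart (m - i), x * y = 0) → x = 0
  nondegenerate_right : ∀ i, ∀ y ∈ D.cohomologyPart (m - i),
    (∀ x ∈ D.cohomologyPart i, x * y = 0) → y = 0

end DGStructure

/-! ### The Sullivan model of the free loop space -/

section Loop

variable (k : Type u) [Field k] (V : ℤ → Type v) [∀ i, AddCommGroup (V i)] [∀ i, Module k (V i)]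

/-- The free graded commutative algebra `∧ V` on a graded vector space `V`. -/
abbrev Wedge : Type (max u v) := FreeGCA k (fun i : ℤ => i) V

/-- The homogeneous parts `(∧ V)^i`. -/
abbrev wedgePart : ℤ → Submodule k (Wedge k V) :=
  FreeGCA.part k (fun i : ℤ => i) V (fun i : ℤ => i)

/-- The degrees of the generators of `∧ V ⊗ ∧ V̄ = ∧ (V ⊕ V̄)`: the index `(i, false)` stands for
the generators `v ∈ V^i`, and `(i, true)` for the generators `v̄` with `v ∈ V^i`, of degree
`i - 1`. -/
def loopDeg : ℤ × Bool → ℤ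
  | (i, false) => i
  | (i, true) => i - 1

/-- The number of factors from `V̄` in a generator of `∧ V ⊗ ∧ V̄`. -/
def barWeight : ℤ × Bool → ℕ
  | (_, false) => 0
  | (_, true) => 1

/-- The algebra `𝓛 = ∧ V ⊗ ∧ V̄ = ∧ (V ⊕ V̄)`. -/
abbrev Loop : Type (max u v) := FreeGCA k loopDeg (fun x => V x.1)

/-- The homogeneous parts `𝓛^i`. -/
abbrev loopPart : ℤ → Submodule k (Loop k V) := FreeGCA.part k loopDeg (fun x => V x.1) loopDeg

/-- The part of degree `i` of `𝓛_(j) = ∧ V ⊗ ∧^j V̄`. -/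
def loopBarPart (j : ℕ) (i : ℤ) : Submodule k (Loop k V) :=
  loopPart k V i ⊓ FreeGCA.part k loopDeg (fun x => V x.1) barWeight j

/-- The generators of `∧ V`. -/
abbrev wgen (i : ℤ) : V i →ₗ[k] Wedge k V := FreeGCA.gen k (fun i : ℤ => i) V i

/-- The generators `v` of `𝓛`. -/
abbrev vgen (i : ℤ) : V i →ₗ[k] Loop k V := FreeGCA.gen k loopDeg (fun x => V x.1) (i, false)

/-- The generators `v̄` of `𝓛`. -/
abbrev bargen (i : ℤ) : V i →ₗ[k] Loop k V := FreeGCA.gen k loopDeg (fun x => V x.1) (i, true)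

/-- The inclusion `∧ V → 𝓛`. -/
def incl : Wedge k V →ₐ[k] Loop k V :=
  FreeGCA.lift (vgen k V) (fun i j v w => FreeGCA.gen_mul_gen (deg := loopDeg)
    (V := fun x : ℤ × Bool => V x.1) (i, false) (j, false) v w)

variable {k V}

theorem incl_gen (i : ℤ) (v : V i) : incl k V (wgen k V i v) = vgen k V i v :=
  FreeGCA.lift_gen (deg := fun i : ℤ => i) (vgen k V) _ i v

theorem incl_mem {i : ℤ} {a : Wedge k V} (ha : a ∈ wedgePart k V i) :
    incl k V a ∈ loopPart k V i := by
  refine FreeGCA.part_induction (P := fun i a => incl k V a ∈ loopPart k V i) ?_ ?_ ?_ ?_ ?_ ha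
  · rw [map_one]
    exact FreeGCA.one_mem_part
  · intro i v m x _ hx
    rw [map_mul, incl_gen]
    exact FreeGCA.gen_mul_mem_part (g := loopDeg) (i, false) v hx
  · simp
  · intro m x y hx hy
    rw [map_add]
    exact add_mem hx hy
  · intro m c x hx
    rw [map_smul]
    exact Submodule.smul_mem _ _ hx

variable (k V) in
/-- The values of a derivation of `𝓛` on the generators, from its values on the `v` and `v̄`. -/
def loopGen (f g : ∀ i, V i →ₗ[k] Loop k V) : ∀ x : ℤ × Bool, V x.1 →ₗ[k] Loop k V
  | (i, false) => f i
  | (i, true) => g i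

section LoopExtend

variable (p : ℤ) (f g : ∀ i, V i →ₗ[k] Loop k V) (hf : ∀ i v, f i v ∈ loopPart k V (i + p))
  (hg : ∀ i v, g i v ∈ loopPart k V (i - 1 + p))

/-- The derivation of `𝓛` of degree `p` with the values `f` on the generators `v` and the values
`g` on the generators `v̄`. -/
def loopExtend : Loop k V →ₗ[k] Loop k V :=
  FreeGCA.extend (V := fun x : ℤ × Bool => V x.1) (deg := loopDeg) p (loopGen k V f g) (by
    rintro ⟨i, _ | _⟩ v
    · exact hf i v
    · exact hg i v)

theorem loopExtend_mem : loopExtend p f g hf hg ∈ Der (loopPart k V) p :=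
  FreeGCA.extend_mem _ _ _

theorem loopExtend_vgen (i : ℤ) (v : V i) : loopExtend p f g hf hg (vgen k V i v) = f i v :=
  FreeGCA.extend_gen (V := fun x : ℤ × Bool => V x.1) (deg := loopDeg) p (loopGen k V f g) _
    (i, false) v

theorem loopExtend_bargen (i : ℤ) (v : V i) : loopExtend p f g hf hg (bargen k V i v) = g i v :=
  FreeGCA.extend_gen (V := fun x : ℤ × Bool => V x.1) (deg := loopDeg) p (loopGen k V f g) _
    (i, true) v

end LoopExtend

theorem wgen_mem (i : ℤ) (v : V i) : wgen k V i v ∈ wedgePart k V i :=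
  FreeGCA.gen_mem_part (deg := fun i : ℤ => i) (g := fun i : ℤ => i) i v

theorem vgen_mem (i : ℤ) (v : V i) : vgen k V i v ∈ loopPart k V i :=
  FreeGCA.gen_mem_part (V := fun x : ℤ × Bool => V x.1) (deg := loopDeg) (g := loopDeg)
    (i, false) v

theorem bargen_mem (i : ℤ) (v : V i) : bargen k V i v ∈ loopPart k V (i - 1) :=
  FreeGCA.gen_mem_part (V := fun x : ℤ × Bool => V x.1) (deg := loopDeg) (g := loopDeg)
    (i, true) v

variable (k V) in
/-- The derivation `s` of `𝓛` of degree `-1` with `s v = v̄` and `s v̄ = 0`. -/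
def loopS : Loop k V →ₗ[k] Loop k V :=
  loopExtend (-1) (bargen k V) (fun _ => 0) bargen_mem (fun _ _ => zero_mem _)

theorem loopS_mem : loopS k V ∈ Der (loopPart k V) (-1) := loopExtend_mem _ _ _ _ _

theorem loopS_vgen (i : ℤ) (v : V i) : loopS k V (vgen k V i v) = bargen k V i v :=
  loopExtend_vgen _ _ _ _ _ i v

theorem loopS_bargen (i : ℤ) (v : V i) : loopS k V (bargen k V i v) = 0 :=
  loopExtend_bargen _ _ _ _ _ i v

theorem loop_der_ext {p : ℤ} {θ η : Loop k V →ₗ[k] Loop k V} (hθ : θ ∈ Der (loopPart k V) p)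
    (hη : η ∈ Der (loopPart k V) p) (h1 : ∀ i v, θ (vgen k V i v) = η (vgen k V i v))
    (h2 : ∀ i v, θ (bargen k V i v) = η (bargen k V i v)) : θ = η := by
  refine FreeGCA.der_ext hθ hη ?_
  rintro ⟨i, _ | _⟩ v
  · exact h1 i v
  · exact h2 i v

theorem loopS_loopS (a : Loop k V) : loopS k V (loopS k V a) = 0 := by
  have h : loopS k V ∘ₗ loopS k V = 0 := by
    refine loop_der_ext (Der.comp_self_mem (by simp) loopS_mem) (zero_mem _) ?_ ?_
    · intro i v
      rw [LinearMap.comp_apply, loopS_vgen, loopS_bargen]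
      rfl
    · intro i v
      rw [LinearMap.comp_apply, loopS_bargen, map_zero]
      rfl
  exact LinearMap.congr_fun h a

/-- If `D` is a derivation of `𝓛` and `θ` a derivation of `∧ V` such that `D v = c θ v` for the
generators `v ∈ V`, then `D a = c θ a` for all `a ∈ ∧ V`. -/
theorem der_incl {p : ℤ} (c : k) {D : Loop k V →ₗ[k] Loop k V} (hD : D ∈ Der (loopPart k V) p)
    {θ : Wedge k V →ₗ[k] Wedge k V} (hθ : θ ∈ Der (wedgePart k V) p)
    (h : ∀ i v, D (vgen k V i v) = c • incl k V (θ (wgen k V i v))) (a : Wedge k V) :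
    D (incl k V a) = c • incl k V (θ a) := by
  induction a using FreeGCA.induction with
  | one => rw [map_one, Der.map_one hD, Der.map_one hθ, map_zero, smul_zero]
  | gen_mul i v x hx =>
    rw [map_mul, incl_gen, hD.2 _ _ (FreeGCA.gen_mem_part (g := loopDeg) (i, false) v), hx, h,
      hθ.2 _ _ (FreeGCA.gen_mem_part i v), map_add, map_smul, map_mul, map_mul, incl_gen,
      smul_add, smul_mul_assoc, mul_smul_comm, smul_comm c]
    rfl
  | add x y hx hy => simp only [map_add, hx, hy, smul_add]
  | smul b x hx => simp only [map_smul, hx, smul_comm c]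

section Differential

variable (D : DGStructure (wedgePart k V))

/-- The differential of `𝓛`: the derivation of degree `1` that extends the differential of `∧ V`
and satisfies `d v̄ = - s d v`, that is `d s + s d = 0`. -/
def loopD : Loop k V →ₗ[k] Loop k V :=
  loopExtend 1 (fun i => (incl k V).toLinearMap ∘ₗ D.d ∘ₗ wgen k V i)
    (fun i => - (loopS k V ∘ₗ (incl k V).toLinearMap ∘ₗ D.d ∘ₗ wgen k V i))
    (fun i v => incl_mem (D.d_mem.1 _ _ (wgen_mem i v)))
    (fun i v => by
      have h := loopS_mem.1 _ _ (incl_mem (D.d_mem.1 _ _ (wgen_mem i v)))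
      rw [add_right_comm] at h
      exact neg_mem h)

theorem loopD_mem : loopD D ∈ Der (loopPart k V) 1 := loopExtend_mem _ _ _ _ _

theorem loopD_vgen (i : ℤ) (v : V i) :
    loopD D (vgen k V i v) = incl k V (D.d (wgen k V i v)) :=
  loopExtend_vgen _ _ _ _ _ i v

theorem loopD_bargen (i : ℤ) (v : V i) :
    loopD D (bargen k V i v) = - loopS k V (incl k V (D.d (wgen k V i v))) :=
  loopExtend_bargen _ _ _ _ _ i v

theorem loopD_incl (a : Wedge k V) : loopD D (incl k V a) = incl k V (D.d a) := by
  have := der_incl 1 (loopD_mem D) D.d_mem (fun i v => by rw [loopD_vgen, one_smul]) a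
  rwa [one_smul] at this

/-- The identity `d s + s d = 0` on `𝓛`. -/
theorem loopD_loopS (a : Loop k V) : loopD D (loopS k V a) = - loopS k V (loopD D a) := by
  have h : loopD D ∘ₗ loopS k V - sgn k (1 * -1) • (loopS k V ∘ₗ loopD D) = 0 := by
    refine loop_der_ext (Der.bracket_mem (loopD_mem D) loopS_mem) (zero_mem _) ?_ ?_
    · intro i v
      simp [loopS_vgen, loopD_bargen, loopD_vgen, sgn_neg]
    · intro i v
      simp [loopS_bargen, loopD_bargen, loopS_loopS]
  have h' := LinearMap.congr_fun h a
  simp only [LinearMap.zero_apply, one_mul, sgn_neg, sgn_one, neg_smul, one_smul, sub_neg_eq_add] at h'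
  exact eq_neg_of_add_eq_zero_left h'

/-- The differential graded algebra `𝓛`. -/
def loopDG : DGStructure (loopPart k V) where
  d := loopD D
  d_mem := loopD_mem D
  d_d := by
    have h : loopD D ∘ₗ loopD D = 0 := by
      refine loop_der_ext (Der.comp_self_mem (by simp) (loopD_mem D)) (zero_mem _) ?_ ?_
      · intro i v
        rw [LinearMap.comp_apply, loopD_vgen, loopD_incl, D.d_d, map_zero]
        rfl
      · intro i v
        rw [LinearMap.comp_apply, loopD_bargen, map_neg, loopD_loopS, loopD_incl, D.d_d, map_zero,
          map_zero, neg_zero, neg_zero]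
        rfl
    exact fun a => LinearMap.congr_fun h a

/-- The map `H(∧ V) → H(𝓛)` induced by the inclusion. -/
def inclCohomology : D.Cohomology →ₗ[k] (loopDG D).Cohomology :=
  D.mapCohomology (loopDG D) (incl k V).toLinearMap
    (fun a ha => by
      change loopD D (incl k V a) = 0
      rw [loopD_incl, ha, map_zero])
    (fun a => ⟨incl k V a, loopD_incl D a⟩)

/-- The cohomology `H^i(𝓛_(j))`. As `𝓛` is the direct sum of its subcomplexes `𝓛_(j)`, it is the
subspace of `H(𝓛)` of the classes of the cocycles in `𝓛_(j)` of degree `i`. -/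
def loopBarCohomology (j : ℕ) (i : ℤ) : Submodule k (loopDG D).Cohomology :=
  (loopDG D).classesOf (loopBarPart k V j i)

/-! #### The contraction -/

variable (k V) in
/-- The contraction `e : Der^p(∧ V) → Der^(p+1)(𝓛)`: the derivation `e_θ` is given by `e_θ v = 0`
and `e_θ v̄ = (-1)^p θ v`. -/
def contractionEnd (p : ℤ) (θ : Der (wedgePart k V) p) : Loop k V →ₗ[k] Loop k V :=
  loopExtend (p + 1) (fun _ => 0)
    (fun i => sgn k p • ((incl k V).toLinearMap ∘ₗ θ.1 ∘ₗ wgen k V i))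
    (fun _ _ => zero_mem _)
    (fun i v => by
      rw [sub_add_add_cancel]
      exact Submodule.smul_mem _ _ (incl_mem (θ.2.1 _ _ (wgen_mem i v))))

theorem contractionEnd_mem (p : ℤ) (θ : Der (wedgePart k V) p) :
    contractionEnd k V p θ ∈ Der (loopPart k V) (p + 1) := loopExtend_mem _ _ _ _ _

theorem contractionEnd_vgen (p : ℤ) (θ : Der (wedgePart k V) p) (i : ℤ) (v : V i) :
    contractionEnd k V p θ (vgen k V i v) = 0 :=
  loopExtend_vgen _ _ _ _ _ i v

theorem contractionEnd_bargen (p : ℤ) (θ : Der (wedgePart k V) p) (i : ℤ) (v : V i) :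
    contractionEnd k V p θ (bargen k V i v) = sgn k p • incl k V (θ.1 (wgen k V i v)) :=
  loopExtend_bargen _ _ _ _ _ i v

variable (k V) in
/-- The contraction as a linear map `e : Der^p(∧ V) → Der^(p+1)(𝓛)`. -/
def contraction (p : ℤ) : Der (wedgePart k V) p →ₗ[k] Der (loopPart k V) (p + 1) where
  toFun θ := ⟨contractionEnd k V p θ, contractionEnd_mem p θ⟩
  map_add' θ η := by
    refine Subtype.ext (loop_der_ext (contractionEnd_mem p _)
      (add_mem (contractionEnd_mem p θ) (contractionEnd_mem p η)) ?_ ?_)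
    · intro i v
      simp [contractionEnd_vgen]
    · intro i v
      simp [contractionEnd_bargen]
  map_smul' c θ := by
    refine Subtype.ext (loop_der_ext (contractionEnd_mem p _)
      (Submodule.smul_mem _ c (contractionEnd_mem p θ)) ?_ ?_)
    · intro i v
      simp [contractionEnd_vgen]
    · intro i v
      simp [contractionEnd_bargen, smul_comm c]

theorem contractionEnd_incl (p : ℤ) (θ : Der (wedgePart k V) p) (a : Wedge k V) :
    contractionEnd k V p θ (incl k V a) = 0 := by
  have := der_incl 1 (contractionEnd_mem p θ) (zero_mem _)
    (fun i v => by simp [contractionEnd_vgen]) a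
  simpa using this

theorem contractionEnd_loopS_incl (p : ℤ) (θ : Der (wedgePart k V) p) (a : Wedge k V) :
    contractionEnd k V p θ (loopS k V (incl k V a)) = sgn k p • incl k V (θ.1 a) := by
  have hm := Der.bracket_mem (contractionEnd_mem p θ) (loopS_mem (k := k) (V := V))
  rw [add_neg_cancel_right] at hm
  have := der_incl (sgn k p) hm θ.2
    (fun i v => by simp [contractionEnd_vgen, loopS_vgen, contractionEnd_bargen]) a
  simpa [contractionEnd_incl] using this

/-- The identity `[d, e_θ] = - e_[d, θ]`. -/
theorem endDiff_contraction (p : ℤ) (θ : Der (wedgePart k V) p) :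
    (loopDG D).endDiff (p + 1) (contraction k V p θ).1 =
      - (contraction k V (p + 1) ⟨D.endDiff p θ.1, D.endDiff_mem θ.2⟩).1 := by
  refine loop_der_ext ((loopDG D).endDiff_mem (contraction k V p θ).2)
    (neg_mem (contraction k V (p + 1) _).2) ?_ ?_
  · intro i v
    rw [DGStructure.endDiff_apply, LinearMap.neg_apply]
    change loopD D (contractionEnd k V p θ _) - _ • contractionEnd k V p θ (loopD D _) =
      - contractionEnd k V (p + 1) _ _
    simp [contractionEnd_vgen, loopD_vgen, contractionEnd_incl]
  · intro i v
    rw [DGStructure.endDiff_apply, LinearMap.neg_apply]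
    change loopD D (contractionEnd k V p θ _) - _ • contractionEnd k V p θ (loopD D _) =
      - contractionEnd k V (p + 1) _ _
    simp [contractionEnd_bargen, loopD_bargen, contractionEnd_loopS_incl, loopD_incl, sgn_add,
      DGStructure.endDiff_apply, smul_sub, ← sub_eq_neg_add]

theorem contraction_mem_derCocycles (p : ℤ) (θ : D.derCocycles p) :
    (contraction k V p (Submodule.inclusion (D.derCocycles_le p) θ)).1 ∈
      (loopDG D).derCocycles (p + 1) := by
  rw [DGStructure.mem_derCocycles]
  refine ⟨(contraction k V p _).2, ?_⟩
  rw [endDiff_contraction]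
  have h : (⟨D.endDiff p (Submodule.inclusion (D.derCocycles_le p) θ).1,
      D.endDiff_mem (Submodule.inclusion (D.derCocycles_le p) θ).2⟩ :
      Der (wedgePart k V) (p + 1)) = 0 :=
    Subtype.ext (D.mem_derCocycles.1 θ.2).2
  rw [h, map_zero, ZeroMemClass.coe_zero, neg_zero]

/-- The contraction on the cocycles of `Der^p(∧ V)`. -/
def contractionCocycle (p : ℤ) : D.derCocycles p →ₗ[k] (loopDG D).derCocycles (p + 1) :=
  LinearMap.codRestrict _ ((Der (loopPart k V) (p + 1)).subtype ∘ₗ contraction k V p ∘ₗ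
    Submodule.inclusion (D.derCocycles_le p)) (contraction_mem_derCocycles D p)

theorem contractionCocycle_coboundary (p : ℤ) :
    (D.derCoboundaries p).submoduleOf (D.derCocycles p) ≤
      ((((loopDG D).derCoboundaries (p + 1)).submoduleOf
        ((loopDG D).derCocycles (p + 1))).comap (contractionCocycle D p)) := by
  obtain ⟨q, rfl⟩ : ∃ q, p = q + 1 := ⟨p - 1, by ring⟩
  rintro ⟨θ, hθ⟩ ⟨η, hη, h⟩
  rw [add_sub_cancel_right] at hη h
  change (contraction k V (q + 1) ⟨θ, hθ.1⟩).1 ∈ (loopDG D).derCoboundaries (q + 1 + 1)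
  rw [DGStructure.derCoboundaries, add_sub_cancel_right]
  refine ⟨- (contraction k V q ⟨η, hη⟩).1, neg_mem (contraction k V q ⟨η, hη⟩).2, ?_⟩
  rw [map_neg, endDiff_contraction, neg_neg]
  congr 2
  exact Subtype.ext h

/-- The map `H(e) : H^p(Der(∧ V)) → H^(p+1)(Der(𝓛))`, `[θ] ↦ [e_θ]`. -/
def contractionCohomology (p : ℤ) :
    D.DerCohomology p →ₗ[k] (loopDG D).DerCohomology (p + 1) :=
  Submodule.mapQ _ _ (contractionCocycle D p) (contractionCocycle_coboundary D p)

/-- The map `H^p(Der(∧ V)) → Der^(p+1)(H(𝓛))`, `[θ] ↦ H(e_θ)`. -/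
def contractionInduced (p : ℤ) :
    D.DerCohomology p →ₗ[k] Der (loopDG D).cohomologyPart (p + 1) :=
  (loopDG D).inducedDer (p + 1) ∘ₗ contractionCohomology D p

/-- `(∧ V, d)` is a simply connected Sullivan algebra: `V` is concentrated in degrees `≥ 2`, and
it is the union of an increasing sequence of graded subspaces `F 0 ⊆ F 1 ⊆ ...` such that `d = 0`
on `F 0` and `d` maps `F (n + 1)` into the subalgebra `∧ (F n)`. -/
structure IsSimplyConnectedSullivan : Prop where
  simply_connected : ∀ i < 2, Subsingleton (V i)
  exists_filtration : ∃ F : ℕ → ∀ i, Submodule k (V i),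
    (∀ n i, F n i ≤ F (n + 1) i) ∧
    (∀ i v, ∃ n, v ∈ F n i) ∧
    (∀ i, ∀ v ∈ F 0 i, D.d (wgen k V i v) = 0) ∧
    ∀ n i, ∀ v ∈ F (n + 1) i,
      D.d (wgen k V i v) ∈ Algebra.adjoin k {x | ∃ j, ∃ w ∈ F n j, wgen k V j w = x}

end Differential

end Loop

end SullivanLoop
end

/-! The module `𝓛_(1)` is free over `∧ V` on `V̄`, and `θ ↦ e_θ` identifies `Der(∧ V)`, up to shift
and sign, with the `∧ V`-linear maps `𝓛_(1) → ∧ V`. An orientation `ε`, that is, a functional that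
kills coboundaries and detects `H^m`, gives the module map `x ↦ ε (x · -)` from `∧ V` to its shifted
dual, and Poincaré duality makes it a quasi-isomorphism. The Sullivan filtration makes `𝓛_(1)`
semifree, so composition with this map should identify the cohomology of `Der(∧ V)` with that of
`Hom_{∧ V}(𝓛_(1), (∧ V)^*) = (𝓛_(1))^*`, the dual of `H(𝓛_(1))`. Thus a class `[θ] ≠ 0` is seen by
some cocycle `x` of `𝓛_(1)` with `ε (e_θ x) ≠ 0`. Then `e_θ x` is a cocycle of `∧ V` of degree `m`
that is not exact, and a multiple of `x` hits `ω`. Injectivity follows because `H(∧ V)` embeds in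
`H(𝓛)`.

Only the injective half of the identification is needed, and it is proved by obstruction theory. If
`ε ∘ e_θ` vanishes on the cocycles of `𝓛_(1)` in degree `m - p - 1`, it equals `g ∘ d` there for
some functional `g`. One builds a derivation `η` with `[d, η] = θ` together with a functional `h`
such that `ε ∘ e_η = (-1)^p g + h ∘ d` on `𝓛_(1)` in degree `m - p`; carrying `h` along is what
makes the induction close. A new generator `v` has `dv` in the part already treated, and the values
of `η` and `h` at `v` come from the lifting property `PoincareDuality.exists_lift`; the obstruction
is treated in `exists_mem_liftRel`. The conditions form a linear relation (`liftRel`), so the values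
can be chosen linearly in `v`. The limit over the filtration is
`mem_derCoboundaries_of_forall_eq_zero`. -/

noncomputable section

namespace SullivanLoop

universe u v

/-! ### Linear algebra -/

section LinearAlgebra

variable {k E X : Type*} [Field k] [AddCommGroup E] [Module k E] [AddCommGroup X] [Module k X]

/-- A linear functional that vanishes on the kernel of `T` in `S` factors through `T` on `S`. -/
theorem exists_dual_comp_eq (S : Submodule k E) (T : E →ₗ[k] X) (f : E →ₗ[k] k)
    (h : ∀ x ∈ S, T x = 0 → f x = 0) : ∃ g : X →ₗ[k] k, ∀ x ∈ S, f x = g (T x) := by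
  have hmem : f ∘ₗ S.subtype ∈ LinearMap.range (T ∘ₗ S.subtype).dualMap := by
    rw [LinearMap.range_dualMap_eq_dualAnnihilator_ker, Submodule.mem_dualAnnihilator]
    exact fun x hx => h x x.2 hx
  obtain ⟨g, hg⟩ := hmem
  exact ⟨g, fun x hx => (LinearMap.congr_fun hg ⟨x, hx⟩).symm⟩

variable (k) in
theorem exists_dual_ne_zero {x : E} (hx : x ≠ 0) : ∃ φ : E →ₗ[k] k, φ x ≠ 0 :=
  not_forall.1 ((Module.forall_dual_apply_eq_zero_iff k x).not.2 hx)

/-- A linear map whose graph over `F` lies in the linear relation `R` can be modified outside `F`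
such that its graph over `F'` lies in `R`. -/
theorem exists_linearMap_graph (R : Submodule k (E × X)) {F F' : Submodule k E} (hF : F ≤ F')
    (u : E →ₗ[k] X) (hu : ∀ v ∈ F, (v, u v) ∈ R) (hR : ∀ v ∈ F', ∃ x, (v, x) ∈ R) :
    ∃ u' : E →ₗ[k] X, (∀ v ∈ F, u' v = u v) ∧ ∀ v ∈ F', (v, u' v) ∈ R := by
  obtain ⟨π, hπ⟩ := F.subtype.exists_leftInverse_of_injective F.ker_subtype
  have hπ' (v) (hv : v ∈ F) : (π v : E) = v := by
    have := LinearMap.congr_fun hπ ⟨v, hv⟩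
    exact congrArg Subtype.val this
  -- Over a field the projection of `R` restricted to `F'` has a linear section. Its second
  -- component, extended to all of `E`, is `t`, whose graph over `F'` lies in `R`.
  let q : (R.comap (F'.subtype.prodMap (LinearMap.id (M := X)))) →ₗ[k] F' :=
    LinearMap.fst k F' X ∘ₗ Submodule.subtype _
  obtain ⟨r, hr⟩ := q.exists_rightInverse_of_surjective (LinearMap.range_eq_top.2 fun v => by
    obtain ⟨x, hx⟩ := hR v v.2
    exact ⟨⟨(v, x), hx⟩, rfl⟩)
  obtain ⟨t, ht⟩ := (LinearMap.snd k F' X ∘ₗ Submodule.subtype _ ∘ₗ r).exists_extend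
  have ht' (v) (hv : v ∈ F') : (v, t v) ∈ R := by
    have h1 : (r ⟨v, hv⟩).1.1 = ⟨v, hv⟩ := LinearMap.congr_fun hr ⟨v, hv⟩
    have h2 : t v = (r ⟨v, hv⟩).1.2 := LinearMap.congr_fun ht ⟨v, hv⟩
    have h3 : (((r ⟨v, hv⟩).1.1 : E), (r ⟨v, hv⟩).1.2) ∈ R := (r ⟨v, hv⟩).2
    rw [h1, ← h2] at h3
    exact h3
  -- With `π` a projection onto `F`, use `u` on the `F`-component and `t` on the remainder; the
  -- graph stays in `R` because `R` is closed under addition.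
  refine ⟨u ∘ₗ F.subtype ∘ₗ π + t ∘ₗ (LinearMap.id - F.subtype ∘ₗ π), fun v hv => ?_,
    fun v hv => ?_⟩
  · simp [hπ' v hv]
  · have := add_mem (hu (π v) (π v).2) (ht' (v - π v) (sub_mem hv (hF (π v).2)))
    simpa using this

/-- A sequence of linear maps that is stationary on each term of an exhaustive filtration has a
limit. -/
theorem exists_linearMap_of_chain (F : ℕ → Submodule k E) (hmono : Monotone F)
    (hex : ∀ v, ∃ n, v ∈ F n) (u : ℕ → E →ₗ[k] X)
    (hu : ∀ n, ∀ v ∈ F n, u (n + 1) v = u n v) :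
    ∃ w : E →ₗ[k] X, ∀ n, ∀ v ∈ F n, w v = u n v := by
  have hle (n m : ℕ) (h : n ≤ m) (v) (hv : v ∈ F n) : u m v = u n v := by
    induction m, h using Nat.le_induction with
    | base => rfl
    | succ m hm ih => rw [hu m v (hmono hm hv), ih]
  choose N hN using hex
  have key (n v) (hv : v ∈ F n) : u (N v) v = u n v := by
    rw [← hle _ _ (le_max_left (N v) n) v (hN v), ← hle _ _ (le_max_right (N v) n) v hv]
  refine ⟨{ toFun := fun v => u (N v) v, map_add' := fun v w => ?_, map_smul' := fun c v => ?_ },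
    fun n v hv => key n v hv⟩
  · have hv := hmono (le_max_left (N v) (N w)) (hN v)
    have hw := hmono (le_max_right (N v) (N w)) (hN w)
    rw [key _ _ hv, key _ _ hw, key _ _ (add_mem hv hw), map_add]
  · rw [key _ _ (Submodule.smul_mem _ c (hN v)), map_smul, RingHom.id_apply]

end LinearAlgebra

/-! ### Graded algebras -/

section Graded

variable {k : Type u} [Field k] {A : Type v} [Ring A] [Algebra k A]
  (𝒜 : ℤ → Submodule k A) [GradedAlgebra 𝒜]

/-- The involution `a ↦ (-1)^(q |a|) a`. -/
def signTwist (q : ℤ) : A →ₗ[k] A :=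
  (DirectSum.toModule k ℤ A fun i => sgn k (q * i) • (𝒜 i).subtype) ∘ₗ
    (DirectSum.decomposeLinearEquiv 𝒜).toLinearMap

variable {𝒜}

theorem signTwist_of_mem (q : ℤ) {i : ℤ} {a : A} (ha : a ∈ 𝒜 i) :
    signTwist 𝒜 q a = sgn k (q * i) • a := by
  simp only [signTwist, LinearMap.comp_apply, LinearEquiv.coe_coe,
    DirectSum.decomposeLinearEquiv_apply, DirectSum.decompose_of_mem 𝒜 ha]
  rw [← DirectSum.lof_eq_of k, DirectSum.toModule_lof]
  rfl

theorem signTwist_mul_of_mem (q : ℤ) (a : A) {j : ℤ} {b : A} (hb : b ∈ 𝒜 j) :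
    signTwist 𝒜 q (a * b) = sgn k (q * j) • (signTwist 𝒜 q a * b) := by
  induction a using DirectSum.Decomposition.inductionOn 𝒜 with
  | zero => simp
  | @homogeneous i a =>
    rw [signTwist_of_mem q a.2, signTwist_of_mem q (SetLike.mul_mem_graded a.2 hb), mul_add,
      sgn_add, mul_comm, mul_smul, smul_mul_assoc]
  | add a a' ha ha' => rw [add_mul, map_add, ha, ha', map_add, add_mul, smul_add]

theorem proj_of_mem {i : ℤ} {a : A} (ha : a ∈ 𝒜 i) : GradedAlgebra.proj 𝒜 i a = a := by
  rw [GradedAlgebra.proj_apply, DirectSum.decompose_of_mem_same 𝒜 ha]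

theorem proj_of_mem_ne {i j : ℤ} (h : i ≠ j) {a : A} (ha : a ∈ 𝒜 i) :
    GradedAlgebra.proj 𝒜 j a = 0 := by
  rw [GradedAlgebra.proj_apply, DirectSum.decompose_of_mem_ne 𝒜 ha h]

theorem proj_mem (i : ℤ) (a : A) : GradedAlgebra.proj 𝒜 i a ∈ 𝒜 i := by
  rw [GradedAlgebra.proj_apply]
  exact SetLike.coe_mem _

theorem Der.proj_apply {p : ℤ} {θ : A →ₗ[k] A} (hθ : θ ∈ Der 𝒜 p) (i : ℤ) (a : A) :
    GradedAlgebra.proj 𝒜 (i + p) (θ a) = θ (GradedAlgebra.proj 𝒜 i a) := by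
  induction a using DirectSum.Decomposition.inductionOn 𝒜 with
  | zero => simp
  | @homogeneous j a =>
    by_cases h : j = i
    · subst h
      rw [proj_of_mem a.2, proj_of_mem (hθ.1 _ _ a.2)]
    · rw [proj_of_mem_ne h a.2, map_zero, proj_of_mem_ne (fun h' => h (by lia)) (hθ.1 _ _ a.2)]
  | add a a' ha ha' => simp only [map_add, ha, ha']

/-! ### Orientations and the quasi-isomorphism to the dual -/

namespace DGStructure

variable (D : DGStructure 𝒜)

theorem cls_eq_zero_iff {x : D.cocycles} : D.cls x = 0 ↔ ∃ a, D.d a = x :=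
  Ideal.Quotient.eq_zero_iff_mem

/-- Since `d` commutes with the projections to homogeneous components up to the shift of degree, the
component of degree `l - 1` of any primitive is again a primitive. -/
theorem exists_homogeneous_primitive {l : ℤ} {z : A} (hz : z ∈ 𝒜 l) (h : ∃ a, D.d a = z) :
    ∃ x ∈ 𝒜 (l - 1), D.d x = z := by
  obtain ⟨a, rfl⟩ := h
  refine ⟨GradedAlgebra.proj 𝒜 (l - 1) a, proj_mem _ _, ?_⟩
  rw [← Der.proj_apply D.d_mem, sub_add_cancel, proj_of_mem hz]

theorem cls_mem_cohomologyPart {i : ℤ} {z : A} (hz : z ∈ 𝒜 i) (hd : D.d z = 0) :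
    D.cls ⟨z, hd⟩ ∈ D.cohomologyPart i := ⟨⟨z, hd⟩, hz, rfl⟩

theorem mul_mem_cohomologyPart {i j : ℤ} {x y : D.Cohomology} (hx : x ∈ D.cohomologyPart i)
    (hy : y ∈ D.cohomologyPart j) : x * y ∈ D.cohomologyPart (i + j) := by
  obtain ⟨x, hx, rfl⟩ := hx
  obtain ⟨y, hy, rfl⟩ := hy
  rw [← cls_mul]
  exact ⟨x * y, SetLike.mul_mem_graded (show x.1 ∈ 𝒜 i from hx) (show y.1 ∈ 𝒜 j from hy), rfl⟩

/-- A linear functional `ε` on `A` is an orientation in degree `m` if it induces a functional on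
`H(A)` that is injective on `H^m(A)`. -/
structure IsOrientation (m : ℤ) (ε : A →ₗ[k] k) : Prop where
  map_d : ∀ a, ε (D.d a) = 0
  exact_of_eq_zero : ∀ z ∈ 𝒜 m, D.d z = 0 → ε z = 0 → ∃ a, D.d a = z

variable {D} {m : ℤ}

theorem PoincareDuality.exists_smul_eq (h : D.PoincareDuality m) {ω : D.Cohomology}
    (hω : ω ∈ D.cohomologyPart m) (h0 : ω ≠ 0) {x : D.Cohomology}
    (hx : x ∈ D.cohomologyPart m) : ∃ c : k, c • ω = x := by
  have h1 := (finrank_eq_one_iff_of_nonzero' (⟨ω, hω⟩ : D.cohomologyPart m)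
    (fun h => h0 (congrArg Subtype.val h))).1 h.finrank_top ⟨x, hx⟩
  obtain ⟨c, hc⟩ := h1
  exact ⟨c, congrArg Subtype.val hc⟩

theorem PoincareDuality.exists_ne_zero (h : D.PoincareDuality m) :
    ∃ ω ∈ D.cohomologyPart m, ω ≠ 0 := by
  have := Module.nontrivial_of_finrank_pos (R := k) (M := D.cohomologyPart m)
    (by rw [h.finrank_top]; exact one_pos)
  obtain ⟨ω, hω⟩ := exists_ne (0 : D.cohomologyPart m)
  exact ⟨ω, ω.2, fun h => hω (Subtype.ext h)⟩

/-- Take a functional on `H(A)` that is nonzero on a generator of `H^m(A)`, pull it back to the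
cocycles and extend it arbitrarily to `A`. No vanishing of `ε` outside degree `m` is needed, as the
pairings below are evaluated in total degree `m` only. -/
theorem PoincareDuality.exists_orientation (h : D.PoincareDuality m) :
    ∃ ε : A →ₗ[k] k, D.IsOrientation m ε := by
  obtain ⟨ω, hω, h0⟩ := h.exists_ne_zero
  obtain ⟨φ, hφ⟩ := exists_dual_ne_zero k h0
  obtain ⟨ε, hε⟩ := (φ ∘ₗ D.cls : D.cocycles →ₗ[k] k).exists_extend
    (p := Subalgebra.toSubmodule D.cocycles)
  have hε' (z : A) (hz : D.d z = 0) : ε z = φ (D.cls ⟨z, hz⟩) :=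
    LinearMap.congr_fun hε ⟨z, hz⟩
  refine ⟨ε, fun a => ?_, fun z hz hd h1 => ?_⟩
  · rw [hε' _ (D.d_d a), D.cls_eq_zero ⟨a, rfl⟩, map_zero]
  · obtain ⟨c, hc⟩ := h.exists_smul_eq hω h0 (D.cls_mem_cohomologyPart hz hd)
    rw [hε' z hd, ← hc, map_smul, smul_eq_mul] at h1
    rw [(mul_eq_zero.1 h1).resolve_right hφ, zero_smul] at hc
    exact D.cls_eq_zero_iff.1 hc.symm

variable {ε : A →ₗ[k] k}

/-- A functional on the cocycles of degree `m - i` that vanishes on the coboundaries is given by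
the multiplication with a cocycle of degree `i`. -/
theorem PoincareDuality.exists_represents (h : D.PoincareDuality m) (hε : D.IsOrientation m ε)
    (i : ℤ) (φ : A →ₗ[k] k) (hφ : ∀ b ∈ 𝒜 (m - i - 1), φ (D.d b) = 0) :
    ∃ c ∈ 𝒜 i, D.d c = 0 ∧ ∀ a ∈ 𝒜 (m - i), D.d a = 0 → φ a = ε (c * a) := by
  have := h.finite
  let Z (j : ℤ) : Submodule k A := 𝒜 j ⊓ LinearMap.ker D.d
  let C (j : ℤ) : Z j →ₗ[k] D.cohomologyPart j :=
    { toFun := fun z => ⟨_, D.cls_mem_cohomologyPart z.2.1 z.2.2⟩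
      map_add' := fun _ _ => rfl
      map_smul' := fun _ _ => rfl }
  have hC (j) : Function.Surjective (C j) := by
    rintro ⟨_, z, hz, rfl⟩
    exact ⟨⟨z, hz, z.2⟩, rfl⟩
  have descend (j : ℤ) (f : A →ₗ[k] k) (hf : ∀ b ∈ 𝒜 (j - 1), f (D.d b) = 0) :
      ∃ g : D.cohomologyPart j →ₗ[k] k, ∀ z, f z.1 = g (C j z) := by
    obtain ⟨g, hg⟩ := exists_dual_comp_eq ⊤ (C j) (f ∘ₗ (Z j).subtype) (fun z _ hz => by
      obtain ⟨x, hx, hxz⟩ := D.exists_homogeneous_primitive z.2.1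
        (D.cls_eq_zero_iff.1 (congrArg Subtype.val hz))
      change f z = 0
      rw [← hxz]
      exact hf x hx)
    exact ⟨g, fun z => hg z trivial⟩
  obtain ⟨ψ, hψ⟩ := descend (m - i) φ hφ
  -- `P` is the functional on `H(A)` induced by `ε`, and `B` the resulting pairing of `H^(m-i)` with
  -- `H^i`.
  let P : D.Cohomology →ₗ[k] k := (D.coboundaries.restrictScalars k).liftQ
    (ε ∘ₗ D.cocycles.val.toLinearMap) (by
      rintro z ⟨a, ha⟩
      change ε z = 0
      rw [← ha, hε.map_d]) ∘ₗ
    (Submodule.Quotient.restrictScalarsEquiv k D.coboundaries).symm.toLinearMap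
  have hP (z : D.cocycles) : P (D.cls z) = ε z := rfl
  let B : D.cohomologyPart (m - i) →ₗ[k] D.cohomologyPart i →ₗ[k] k :=
    (((LinearMap.mul k D.Cohomology).compr₂ P).flip.domRestrict₁₂ _ _)
  have hB (y x) : B y x = P (x.1 * y.1) := rfl
  have hinj : Function.Injective B := by
    rw [injective_iff_map_eq_zero]
    intro y hy
    refine Subtype.ext (h.nondegenerate_right i y y.2 fun x hx => ?_)
    have h1 : P (x * y) = 0 := LinearMap.congr_fun hy ⟨x, hx⟩
    have h2 := D.mul_mem_cohomologyPart hx y.2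
    rw [add_sub_cancel] at h2
    obtain ⟨z, hz, hz'⟩ := h2
    rw [← hz', hP] at h1
    rw [← hz']
    exact D.cls_eq_zero_iff.2 (hε.exact_of_eq_zero z hz z.2 h1)
  -- In finite dimension, injectivity of `H^(m-i) → (H^i)^*` is surjectivity of the transpose `H^i →
  -- (H^(m-i))^*`.
  obtain ⟨x, hx⟩ := LinearMap.flip_surjective_iff₁.2 hinj ψ
  obtain ⟨c, rfl⟩ := hC i x
  refine ⟨c, c.2.1, c.2.2, fun a ha hd => ?_⟩
  rw [hψ ⟨a, ha, hd⟩, ← hx]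
  rfl

/-- The map `x ↦ ε (x · -)` from `A` to its dual satisfies the lifting property of a
quasi-isomorphism. -/
theorem PoincareDuality.exists_lift (h : D.PoincareDuality m) (hε : D.IsOrientation m ε)
    {l : ℤ} {z : A} (hz : z ∈ 𝒜 l) (hd : D.d z = 0) (φ : A →ₗ[k] k)
    (hφ : ∀ b ∈ 𝒜 (m - l), φ (D.d b) = sgn k l * ε (z * b)) :
    ∃ x ∈ 𝒜 (l - 1), D.d x = z ∧ ∃ ψ : A →ₗ[k] k,
      ∀ a ∈ 𝒜 (m - (l - 1)), φ a = ε (x * a) + ψ (D.d a) := by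
  -- The class of `z` pairs to zero with each cocycle `b`, since `ε (z b) = ± φ (d b) = 0`;
  -- nondegeneracy then makes `z` exact.
  have hexact : ∃ a, D.d a = z := by
    refine (D.cls_eq_zero_iff (x := ⟨z, hd⟩)).1
      (h.nondegenerate_left l _ (D.cls_mem_cohomologyPart hz hd) ?_)
    rintro _ ⟨b, hb, rfl⟩
    rw [← cls_mul, D.cls_eq_zero_iff]
    have h1 := SetLike.mul_mem_graded hz (show b.1 ∈ 𝒜 (m - l) from hb)
    rw [add_sub_cancel] at h1
    refine hε.exact_of_eq_zero _ h1 (D.cocycles.mul_mem (x := z) hd b.2) ?_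
    have h2 := hφ b hb
    rw [D.mem_cocycles.1 b.2, map_zero, eq_comm] at h2
    exact (mul_eq_zero.1 h2).resolve_left (left_ne_zero_of_mul_eq_one (sgn_mul_self l))
  obtain ⟨x, hx, hxz⟩ := D.exists_homogeneous_primitive hz hexact
  -- The defect `φ - ε (x · -)` kills coboundaries, so on cocycles it is multiplication by a cocycle
  -- `c`. Replacing `x` by `x + c` keeps `d x = z` and makes the defect vanish on cocycles, hence
  -- factor through `d`.
  obtain ⟨c, hc, hdc, hc'⟩ := h.exists_represents hε (l - 1)
    (φ - ε ∘ₗ LinearMap.mulLeft k x) (fun b hb => by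
      have h1 := hε.map_d (x * b)
      rw [D.d_mem.2 _ _ hx, map_add, map_smul, hxz, one_mul, sgn_sub, sgn_one, smul_eq_mul] at h1
      rw [show m - (l - 1) - 1 = m - l by ring] at hb
      have h2 := hφ b hb
      simp only [LinearMap.sub_apply, LinearMap.comp_apply, LinearMap.mulLeft_apply]
      rw [h2]
      have h3 : sgn k l * sgn k l = 1 := sgn_mul_self l
      linear_combination sgn k l * h1 + ε (x * D.d b) * h3)
  obtain ⟨ψ, hψ⟩ := exists_dual_comp_eq (𝒜 (m - (l - 1))) D.d
    (φ - ε ∘ₗ LinearMap.mulLeft k (x + c)) (fun a ha hda => by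
      have := hc' a ha hda
      simp only [LinearMap.sub_apply, LinearMap.comp_apply, LinearMap.mulLeft_apply] at this ⊢
      rw [add_mul, map_add, ← this]
      ring)
  refine ⟨x + c, add_mem hx hc, by rw [map_add, hxz, hdc, add_zero], ψ, fun a ha => ?_⟩
  rw [← hψ a ha]
  simp

end DGStructure

end Graded

/-! ### The part of `𝓛` of bar weight one -/

section Loop

variable {k : Type u} [Field k] {V : ℤ → Type v} [∀ i, AddCommGroup (V i)] [∀ i, Module k (V i)]

variable (k V) in
/-- The values on the generators of the projection `𝓛 → ∧ V`. -/
def loopProjGen : ∀ x : ℤ × Bool, V x.1 →ₗ[k] Wedge k V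
  | (i, false) => wgen k V i
  | (_, true) => 0

variable (k V) in
/-- The projection `𝓛 → ∧ V` with kernel generated by `V̄`. -/
def loopProj : Loop k V →ₐ[k] Wedge k V :=
  FreeGCA.lift (V := fun x : ℤ × Bool => V x.1) (deg := loopDeg) (loopProjGen k V) (by
    rintro ⟨i, _ | _⟩ ⟨j, _ | _⟩ v w
    · exact FreeGCA.gen_mul_gen (deg := fun i : ℤ => i) i j v w
    all_goals simp [loopProjGen])

theorem loopProj_incl (a : Wedge k V) : loopProj k V (incl k V a) = a := by
  have h : (loopProj k V).comp (incl k V) = AlgHom.id k _ := FreeGCA.algHom_ext fun i v => by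
    rw [AlgHom.comp_apply, incl_gen]
    exact FreeGCA.lift_gen (V := fun x : ℤ × Bool => V x.1) (deg := loopDeg) _ _ (i, false) v
  exact DFunLike.congr_fun h a

theorem loopProj_bargen (i : ℤ) (v : V i) : loopProj k V (bargen k V i v) = 0 :=
  FreeGCA.lift_gen (V := fun x : ℤ × Bool => V x.1) (deg := loopDeg) _ _ (i, true) v

theorem loopProj_mem {i : ℤ} {x : Loop k V} (hx : x ∈ loopPart k V i) :
    loopProj k V x ∈ wedgePart k V i := by
  refine FreeGCA.part_induction (P := fun i x => loopProj k V x ∈ wedgePart k V i)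
    ?_ ?_ ?_ ?_ ?_ hx
  · rw [map_one]
    exact FreeGCA.one_mem_part
  · rintro ⟨i, _ | _⟩ v m x _ hx
    · rw [map_mul, ← incl_gen, loopProj_incl]
      exact FreeGCA.gen_mul_mem_part (g := fun i : ℤ => i) i v hx
    · rw [map_mul, loopProj_bargen, zero_mul]
      exact zero_mem _
  · simp
  · intro m x y hx hy
    rw [map_add]
    exact add_mem hx hy
  · intro m c x hx
    rw [map_smul]
    exact Submodule.smul_mem _ _ hx

/-! ### Functionals on `𝓛_(1)` with prescribed values on `v̄ a` -/

section BarFunctional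

variable (H : ∀ i, V i →ₗ[k] Wedge k V →ₗ[k] k)

/-- The values `a ↦ (b ↦ (-1)^(|v̄| |b|) H v (b a))` of the generators `v̄` in the representation
that defines `barFunctional`. -/
def barPairing (i : ℤ) : V i →ₗ[k] Wedge k V →ₗ[k] (Wedge k V →ₗ[k] k) where
  toFun v :=
    { toFun := fun a => H i v ∘ₗ LinearMap.mulRight k a ∘ₗ signTwist (wedgePart k V) (i - 1)
      map_add' := fun a b => by
        ext c
        simp [mul_add]
      map_smul' := fun c a => by
        ext b
        simp }
  map_add' v w := by
    ext a b
    simp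
  map_smul' c v := by
    ext a b
    simp

theorem barPairing_apply (i : ℤ) (v : V i) (a b : Wedge k V) :
    barPairing H i v a b = H i v (signTwist (wedgePart k V) (i - 1) b * a) := rfl

/-- The representation of the generators of `𝓛` on `(∧ V)^* × ∧ V` that defines
`barFunctional`. -/
def barRepGen : ∀ x : ℤ × Bool, V x.1 →ₗ[k] Module.End k ((Wedge k V →ₗ[k] k) × Wedge k V)
  | (i, false) =>
    { toFun := fun v => LinearMap.prodMap (LinearMap.mulRight k (wgen k V i v)).dualMap
        (LinearMap.mulLeft k (wgen k V i v))
      map_add' := fun v w => LinearMap.ext fun x => Prod.ext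
        (LinearMap.ext fun b => by simp [LinearMap.dualMap_apply, mul_add]) (by simp [add_mul])
      map_smul' := fun c v => LinearMap.ext fun x => Prod.ext
        (LinearMap.ext fun b => by simp [LinearMap.dualMap_apply]) (by simp) }
  | (i, true) =>
    { toFun := fun v => LinearMap.inl k _ _ ∘ₗ barPairing H i v ∘ₗ LinearMap.snd k _ _
      map_add' := fun v w => by
        rw [map_add, LinearMap.add_comp, LinearMap.comp_add]
      map_smul' := fun c v => by
        rw [map_smul, LinearMap.smul_comp, LinearMap.comp_smul, RingHom.id_apply] }

theorem barRepGen_false (i : ℤ) (v : V i) (φ : Wedge k V →ₗ[k] k) (a : Wedge k V) :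
    barRepGen H (i, false) v (φ, a) =
      (φ ∘ₗ LinearMap.mulRight k (wgen k V i v), wgen k V i v * a) := rfl

theorem barRepGen_true (i : ℤ) (v : V i) (φ : Wedge k V →ₗ[k] k) (a : Wedge k V) :
    barRepGen H (i, true) v (φ, a) = (barPairing H i v a, 0) := rfl

/-- The twist in `barPairing` is there for this identity: moving `v̄` past `w` costs exactly the
Koszul sign `(-1)^(|v̄| |w|)`. -/
theorem barPairing_wgen_mul (i j : ℤ) (v : V i) (w : V j) (a : Wedge k V) :
    barPairing H i v (wgen k V j w * a) =
      sgn k ((i - 1) * j) • (barPairing H i v a ∘ₗ LinearMap.mulRight k (wgen k V j w)) := by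
  ext b
  rw [LinearMap.smul_apply, LinearMap.comp_apply, LinearMap.mulRight_apply, barPairing_apply,
    barPairing_apply, signTwist_mul_of_mem _ _ (wgen_mem j w), smul_mul_assoc, map_smul, smul_smul,
    sgn_mul_self, one_smul, mul_assoc]

/-- Two unbarred generators commute by graded commutativity of `∧ V`, and the mixed cases are
`barPairing_wgen_mul`. Two barred generators compose to zero, since each maps into the factor `(∧
V)^*` and kills it. -/
theorem barRepGen_comm (x y : ℤ × Bool) (v : V x.1) (w : V y.1) :
    barRepGen H x v * barRepGen H y w =
      sgn k (loopDeg x * loopDeg y) • (barRepGen H y w * barRepGen H x v) := by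
  obtain ⟨i, _ | _⟩ := x <;> obtain ⟨j, _ | _⟩ := y <;> refine LinearMap.ext fun ⟨φ, a⟩ => ?_ <;>
    rw [LinearMap.smul_apply, Module.End.mul_apply, Module.End.mul_apply]
  · have h := FreeGCA.gen_mul_gen (k := k) (deg := fun i : ℤ => i) i j v w
    simp only [barRepGen_false, loopDeg]
    refine Prod.ext (LinearMap.ext fun b => ?_) ?_
    · simp only [LinearMap.comp_apply, LinearMap.mulRight_apply, Prod.smul_fst,
        LinearMap.smul_apply]
      rw [mul_assoc, mul_assoc, ← map_smul, ← mul_smul_comm, h]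
    · simp only [Prod.smul_snd]
      rw [← mul_assoc, ← mul_assoc, ← smul_mul_assoc, h]
  · simp only [barRepGen_false, barRepGen_true, loopDeg]
    rw [barPairing_wgen_mul, Prod.smul_mk, smul_smul, mul_comm i, sgn_mul_self, one_smul, mul_zero,
      smul_zero]
  · simp only [barRepGen_false, barRepGen_true, loopDeg]
    rw [barPairing_wgen_mul, Prod.smul_mk, mul_zero, smul_zero]
  · simp only [barRepGen_true]
    rw [map_zero, map_zero, Prod.mk_zero_zero, smul_zero]

/-- The representation of `𝓛` on `(∧ V)^* × ∧ V` that defines `barFunctional`. -/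
def barRep : Loop k V →ₐ[k] Module.End k ((Wedge k V →ₗ[k] k) × Wedge k V) :=
  FreeGCA.lift (V := fun x : ℤ × Bool => V x.1) (deg := loopDeg) (barRepGen H) (barRepGen_comm H)

theorem barRep_vgen (i : ℤ) (v : V i) : barRep H (vgen k V i v) = barRepGen H (i, false) v :=
  FreeGCA.lift_gen (V := fun x : ℤ × Bool => V x.1) (deg := loopDeg) _ _ (i, false) v

theorem barRep_bargen (i : ℤ) (v : V i) : barRep H (bargen k V i v) = barRepGen H (i, true) v :=
  FreeGCA.lift_gen (V := fun x : ℤ × Bool => V x.1) (deg := loopDeg) _ _ (i, true) v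

theorem barRep_incl (a : Wedge k V) : (barRep H (incl k V a) (0, 1)).2 = a := by
  induction a using FreeGCA.induction with
  | one => simp
  | gen_mul i v x hx =>
    rw [map_mul, map_mul, Module.End.mul_apply, incl_gen, barRep_vgen]
    exact congrArg (wgen k V i v * ·) hx
  | add x y hx hy => rw [map_add, map_add, LinearMap.add_apply, Prod.snd_add, hx, hy]
  | smul c x hx => rw [map_smul, map_smul, LinearMap.smul_apply, Prod.smul_snd, hx]

/-- The linear functional on `𝓛` that maps `v̄ a` to `H v a`. It exists as `𝓛_(1)` is a free
module over `∧ V`. -/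
def barFunctional : Loop k V →ₗ[k] k :=
  LinearMap.applyₗ (1 : Wedge k V) ∘ₗ LinearMap.fst k _ _ ∘ₗ LinearMap.applyₗ (0, 1) ∘ₗ
    (barRep H).toLinearMap

/-- Acting on `(0, 1)`, the element `a` leaves `a` in the second factor; `v̄` then turns it into the
functional `b ↦ ± H v (b a)`, which is evaluated at `1`, where the sign is trivial. -/
theorem barFunctional_bargen_mul (i : ℤ) (v : V i) (a : Wedge k V) :
    barFunctional H (bargen k V i v * incl k V a) = H i v a := by
  change (barRep H (bargen k V i v * incl k V a) (0, 1)).1 1 = _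
  rw [map_mul, Module.End.mul_apply, barRep_bargen]
  change barPairing H i v (barRep H (incl k V a) (0, 1)).2 1 = _
  rw [barRep_incl, barPairing_apply,
    signTwist_of_mem _ (FreeGCA.one_mem_part (k := k) (g := fun i : ℤ => i)), mul_zero, sgn_zero,
    one_smul, one_mul]

end BarFunctional

/-! ### Submodules of `𝓛_(1)` generated by part of `V̄` -/

section BarSpan

variable (F : ∀ i, Submodule k (V i))

/-- The subalgebra `∧ F` of `∧ V` for a graded subspace `F` of `V`. -/
def subWedge : Subalgebra k (Wedge k V) :=
  Algebra.adjoin k {x | ∃ j, ∃ w ∈ F j, wgen k V j w = x}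

variable {F} in
theorem subWedge_induction {P : Wedge k V → Prop} (one : P 1)
    (gen_mul : ∀ i, ∀ v ∈ F i, ∀ x, P x → P (wgen k V i v * x))
    (add : ∀ x y, P x → P y → P (x + y)) (smul : ∀ (c : k) x, P x → P (c • x)) {x : Wedge k V}
    (hx : x ∈ subWedge F) : P x := by
  rw [subWedge, ← Subalgebra.mem_toSubmodule, Algebra.adjoin_eq_span] at hx
  induction hx using Submodule.span_induction with
  | mem x hx =>
    induction hx using Submonoid.closure_induction_left with
    | one => exact one
    | mul_left x hx y hy ih =>
      obtain ⟨i, v, hv, rfl⟩ := hx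
      exact gen_mul i v hv y ih
  | zero => simpa using smul 0 1 one
  | add x y _ _ hx hy => exact add x y hx hy
  | smul c x _ hx => exact smul c x hx

theorem Der.eqOn_subWedge {p : ℤ} {θ η : Wedge k V →ₗ[k] Wedge k V}
    (hθ : θ ∈ Der (wedgePart k V) p) (hη : η ∈ Der (wedgePart k V) p)
    (h : ∀ i, ∀ v ∈ F i, θ (wgen k V i v) = η (wgen k V i v)) {x : Wedge k V}
    (hx : x ∈ subWedge F) : θ x = η x := by
  refine subWedge_induction (P := fun x => θ x = η x) ?_ ?_ ?_ ?_ hx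
  · rw [Der.map_one hθ, Der.map_one hη]
  · intro i v hv x hx
    rw [hθ.2 _ _ (wgen_mem i v), hη.2 _ _ (wgen_mem i v), h i v hv, hx]
  · intro x y hx hy
    rw [map_add, map_add, hx, hy]
  · intro c x hx
    rw [map_smul, map_smul, hx]

/-- The subspace of `𝓛_(1)` spanned by the elements `v̄ a` with `v ∈ F` and `a ∈ ∧ V`. -/
def barSpan : Submodule k (Loop k V) :=
  Submodule.span k {x | ∃ i, ∃ v ∈ F i, ∃ a, bargen k V i v * incl k V a = x}

/-- The subspace of `𝓛_(1)` spanned by the elements `v̄ a` of degree `r` with `v ∈ F` and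
`a ∈ ∧ V`. -/
def barSpanPart (r : ℤ) : Submodule k (Loop k V) :=
  Submodule.span k {x | ∃ i, ∃ v ∈ F i, ∃ j, ∃ a ∈ wedgePart k V j, i - 1 + j = r ∧
    bargen k V i v * incl k V a = x}

variable {F}

theorem bargen_mul_mem_barSpan {i : ℤ} {v : V i} (hv : v ∈ F i) (a : Wedge k V) :
    bargen k V i v * incl k V a ∈ barSpan F := Submodule.subset_span ⟨i, v, hv, a, rfl⟩

theorem vgen_mul_bargen (i j : ℤ) (v : V i) (w : V j) :
    vgen k V i v * bargen k V j w =
      sgn k (i * (j - 1)) • (bargen k V j w * vgen k V i v) :=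
  FreeGCA.gen_mul_gen (V := fun x : ℤ × Bool => V x.1) (deg := loopDeg) (i, false) (j, true) v w

theorem vgen_mul_mem_barSpan (i : ℤ) (v : V i) {x : Loop k V} (hx : x ∈ barSpan F) :
    vgen k V i v * x ∈ barSpan F := by
  induction hx using Submodule.span_induction with
  | mem x hx =>
    obtain ⟨j, w, hw, a, rfl⟩ := hx
    rw [← mul_assoc, vgen_mul_bargen, smul_mul_assoc, mul_assoc, ← incl_gen, ← map_mul]
    exact Submodule.smul_mem _ _ (bargen_mul_mem_barSpan hw _)
  | zero => simp
  | add x y _ _ hx hy => rw [mul_add]; exact add_mem hx hy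
  | smul c x _ hx => rw [mul_smul_comm]; exact Submodule.smul_mem _ _ hx

theorem mul_incl_mem_barSpan {x : Loop k V} (hx : x ∈ barSpan F) (b : Wedge k V) :
    x * incl k V b ∈ barSpan F := by
  induction hx using Submodule.span_induction with
  | mem x hx =>
    obtain ⟨j, w, hw, a, rfl⟩ := hx
    rw [mul_assoc, ← map_mul]
    exact bargen_mul_mem_barSpan hw _
  | zero => simp
  | add x y _ _ hx hy => rw [add_mul]; exact add_mem hx hy
  | smul c x _ hx => rw [smul_mul_assoc]; exact Submodule.smul_mem _ _ hx

/-- The derivation `s` bars one factor of a monomial at a time, and the barred factor can be moved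
to the front. Through `d v̄ = - s d v` this shows that `d v̄` involves only bars from `F` when `d v
∈ ∧ F`. -/
theorem loopS_incl_mem_barSpan {x : Wedge k V} (hx : x ∈ subWedge F) :
    loopS k V (incl k V x) ∈ barSpan F := by
  refine subWedge_induction (P := fun x => loopS k V (incl k V x) ∈ barSpan F) ?_ ?_ ?_ ?_ hx
  · rw [map_one, Der.map_one loopS_mem]
    exact zero_mem _
  · intro i v hv x hx
    rw [map_mul, incl_gen, loopS_mem.2 _ _ (vgen_mem i v), loopS_vgen]
    exact add_mem (bargen_mul_mem_barSpan hv x)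
      (Submodule.smul_mem _ _ (vgen_mul_mem_barSpan i v hx))
  · intro x y hx hy
    rw [map_add, map_add]
    exact add_mem hx hy
  · intro c x hx
    rw [map_smul, map_smul]
    exact Submodule.smul_mem _ _ hx

theorem bargen_mul_mem {i j r : ℤ} (v : V i) {a : Wedge k V} (ha : a ∈ wedgePart k V j)
    (h : i - 1 + j = r) : bargen k V i v * incl k V a ∈ loopPart k V r :=
  h ▸ SetLike.mul_mem_graded (bargen_mem i v) (incl_mem ha)

/-- Projecting `v̄ a` to degree `r` selects one homogeneous component of `a`. This is needed because
the condition on a lift is imposed only in the degree where `ε` is used. -/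
theorem mem_barSpanPart {r : ℤ} {x : Loop k V} (hx : x ∈ barSpan F) (hr : x ∈ loopPart k V r) :
    x ∈ barSpanPart F r := by
  rw [← proj_of_mem hr]
  clear hr
  induction hx using Submodule.span_induction with
  | mem x hx =>
    obtain ⟨i, v, hv, a, rfl⟩ := hx
    induction a using DirectSum.Decomposition.inductionOn (wedgePart k V) with
    | zero => simp
    | @homogeneous j a =>
      by_cases h : i - 1 + j = r
      · rw [proj_of_mem (bargen_mul_mem v a.2 h)]
        exact Submodule.subset_span ⟨i, v, hv, j, a, a.2, h, rfl⟩
      · rw [proj_of_mem_ne h (bargen_mul_mem v a.2 rfl)]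
        exact zero_mem _
    | add a b ha hb => rw [map_add, mul_add, map_add]; exact add_mem ha hb
  | zero => rw [map_zero]; exact zero_mem _
  | add x y _ _ hx hy => rw [map_add]; exact add_mem hx hy
  | smul c x _ hx => rw [map_smul]; exact Submodule.smul_mem _ _ hx

theorem barFunctional_congr {H H' : ∀ i, V i →ₗ[k] Wedge k V →ₗ[k] k}
    (h : ∀ i, ∀ v ∈ F i, H i v = H' i v) {x : Loop k V} (hx : x ∈ barSpan F) :
    barFunctional H x = barFunctional H' x := by
  induction hx using Submodule.span_induction with
  | mem x hx =>
    obtain ⟨i, v, hv, a, rfl⟩ := hx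
    rw [barFunctional_bargen_mul, barFunctional_bargen_mul, h i v hv]
  | zero => simp
  | add x y _ _ hx hy => rw [map_add, map_add, hx, hy]
  | smul c x _ hx => rw [map_smul, map_smul, hx]

theorem incl_mem_barWeight (a : Wedge k V) :
    incl k V a ∈ FreeGCA.part k loopDeg (fun x : ℤ × Bool => V x.1) barWeight 0 := by
  induction a using FreeGCA.induction with
  | one => rw [map_one]; exact FreeGCA.one_mem_part
  | gen_mul i v x hx =>
    have h := FreeGCA.gen_mul_mem_part (i, false) v hx
    have hw : barWeight (i, false) + 0 = 0 := rfl
    rwa [hw, ← incl_gen, ← map_mul] at h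
  | add x y hx hy => rw [map_add]; exact add_mem hx hy
  | smul c x hx => rw [map_smul]; exact Submodule.smul_mem _ _ hx

theorem bargen_mul_mem_loopBarPart {i j r : ℤ} (v : V i) {a : Wedge k V}
    (ha : a ∈ wedgePart k V j) (h : i - 1 + j = r) :
    bargen k V i v * incl k V a ∈ loopBarPart k V 1 r := by
  refine ⟨bargen_mul_mem v ha h, ?_⟩
  have h := FreeGCA.gen_mul_mem_part (i, true) v (incl_mem_barWeight a)
  have hw : barWeight (i, true) + 0 = 1 := rfl
  rwa [hw] at h

end BarSpan

/-! ### The contraction on bar weights zero and one -/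

section Contraction

variable (p : ℤ) (θ : Der (wedgePart k V) p)

theorem contractionEnd_bargen_mul (i : ℤ) (v : V i) (a : Wedge k V) :
    contractionEnd k V p θ (bargen k V i v * incl k V a) =
      sgn k p • incl k V (θ.1 (wgen k V i v) * a) := by
  rw [(contractionEnd_mem p θ).2 _ _ (bargen_mem i v), contractionEnd_incl, mul_zero, smul_zero,
    add_zero, contractionEnd_bargen, smul_mul_assoc, map_mul]

/-- The derivation `e_θ` lowers the bar weight by one, and bar weight zero is the image of `∧ V`, on
which `incl ∘ loopProj` is the identity. Both weights go into one induction since removing a barred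
generator from weight one leaves weight zero. -/
theorem contractionEnd_barWeight {j : ℕ} {x : Loop k V}
    (hx : x ∈ FreeGCA.part k loopDeg (fun x : ℤ × Bool => V x.1) barWeight j) :
    (j = 0 → incl k V (loopProj k V x) = x) ∧
      (j = 1 → incl k V (loopProj k V (contractionEnd k V p θ x)) = contractionEnd k V p θ x) := by
  refine FreeGCA.part_induction (P := fun j x => (j = 0 → incl k V (loopProj k V x) = x) ∧
      (j = 1 → incl k V (loopProj k V (contractionEnd k V p θ x)) = contractionEnd k V p θ x))
    ?_ ?_ ?_ ?_ ?_ hx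
  · simp
  · rintro ⟨i, _ | _⟩ v m x _ ⟨h0, h1⟩
    · have hv : contractionEnd k V p θ (vgen k V i v * x) = sgn k ((p + 1) * i) •
          (vgen k V i v * contractionEnd k V p θ x) := by
        rw [(contractionEnd_mem p θ).2 _ _ (vgen_mem i v), contractionEnd_vgen, zero_mul, zero_add]
      have hw : barWeight (i, false) + m = m := zero_add m
      rw [hw]
      refine ⟨fun hm => ?_, fun hm => ?_⟩
      · rw [map_mul, map_mul, h0 hm, ← incl_gen, loopProj_incl]
      · change incl k V (loopProj k V (contractionEnd k V p θ (vgen k V i v * x))) =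
          contractionEnd k V p θ (vgen k V i v * x)
        rw [hv, map_smul, map_smul, map_mul, map_mul, h1 hm, ← incl_gen, loopProj_incl]
    · have hw : barWeight (i, true) + m = m + 1 := add_comm 1 m
      rw [hw]
      refine ⟨fun hm => absurd hm (Nat.succ_ne_zero m), fun hm => ?_⟩
      rw [← h0 (Nat.succ_injective hm)]
      change incl k V (loopProj k V (contractionEnd k V p θ (bargen k V i v * _))) =
          contractionEnd k V p θ (bargen k V i v * _)
      rw [contractionEnd_bargen_mul, map_smul, map_smul, loopProj_incl]
  · simp
  · rintro m x y ⟨hx, hx'⟩ ⟨hy, hy'⟩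
    exact ⟨fun h => by rw [map_add, map_add, hx h, hy h],
      fun h => by rw [map_add, map_add, map_add, hx' h, hy' h]⟩
  · rintro m c x ⟨hx, hx'⟩
    exact ⟨fun h => by rw [map_smul, map_smul, hx h],
      fun h => by rw [map_smul, map_smul, map_smul, hx' h]⟩

end Contraction

end Loop

/-! ### Lifting functionals on `𝓛_(1)` to derivations of `∧ V` -/

section Lifting

variable {k : Type u} [Field k] {V : ℤ → Type v} [∀ i, AddCommGroup (V i)] [∀ i, Module k (V i)]

variable (k V) in
/-- The values on `V i` of a derivation of `∧ V` of degree `q` and of a functional on `𝓛_(1)`. -/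
abbrev LiftValue (q i : ℤ) : Type (max u v) := wedgePart k V (i + q) × (Wedge k V →ₗ[k] k)

/-! ### Derivations and functionals from values on generators -/

section Values

variable {q : ℤ} (w : ∀ i, V i →ₗ[k] LiftValue k V q i)

/-- The derivation of `∧ V` with the values `w` on the generators. -/
def liftDer : Der (wedgePart k V) q :=
  ⟨FreeGCA.extend q (fun i => (wedgePart k V (i + q)).subtype ∘ₗ LinearMap.fst k _ _ ∘ₗ w i)
    (fun i v => (w i v).1.2), FreeGCA.extend_mem _ _ _⟩

theorem liftDer_wgen (i : ℤ) (v : V i) : (liftDer w).1 (wgen k V i v) = (w i v).1 :=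
  FreeGCA.extend_gen (deg := fun i : ℤ => i) _ _ _ i v

/-- The functional on `𝓛_(1)` with the values `w`. -/
def liftFunctional : Loop k V →ₗ[k] k := barFunctional fun i => LinearMap.snd k _ _ ∘ₗ w i

theorem liftFunctional_bargen_mul (i : ℤ) (v : V i) (a : Wedge k V) :
    liftFunctional w (bargen k V i v * incl k V a) = (w i v).2 a :=
  barFunctional_bargen_mul _ i v a

end Values

variable (D : DGStructure (wedgePart k V))

theorem loopD_bargen_mul (i : ℤ) (v : V i) (a : Wedge k V) :
    loopD D (bargen k V i v * incl k V a) = loopD D (bargen k V i v) * incl k V a +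
      sgn k (i - 1) • (bargen k V i v * incl k V (D.d a)) := by
  rw [(loopD_mem D).2 _ _ (bargen_mem i v), loopD_incl, one_mul]

theorem loopD_bargen_mul_mem {F : ∀ i, Submodule k (V i)} {i : ℤ} {v : V i}
    (hv : D.d (wgen k V i v) ∈ subWedge F) (a : Wedge k V) :
    loopD D (bargen k V i v) * incl k V a ∈ barSpan F := by
  rw [loopD_bargen]
  exact mul_incl_mem_barSpan (neg_mem (loopS_incl_mem_barSpan hv)) a

/-- The linear relation between `v ∈ V i` and the values at `v` of a derivation `η` and a
functional `h` which expresses that `[d, η] = θ` and that `ε ∘ e_η` and `± g` differ by the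
coboundary of `h`. -/
def liftRel (p m : ℤ) (θ η : Wedge k V →ₗ[k] Wedge k V) (ε : Wedge k V →ₗ[k] k)
    (g h : Loop k V →ₗ[k] k) (i : ℤ) : Submodule k (V i × LiftValue k V (p - 1) i) where
  -- The second condition is `ε (e_η (v̄ a)) = (-1)^p g (v̄ a) + h (d (v̄ a))`, solved for `ε (η v ·
  -- a)`. Expanding `d (v̄ a)` separates the term with `d v̄`, which uses `h` on earlier generators,
  -- from the term with `v̄ · d a`, where the new value `y.2.2` of `h` at `v` enters.
  carrier := {y | D.d y.2.1 = θ (wgen k V i y.1) - sgn k p • η (D.d (wgen k V i y.1)) ∧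
    ∀ a ∈ wedgePart k V (m - (i + p - 1)), ε (y.2.1 * a) = - g (bargen k V i y.1 * incl k V a) -
      sgn k p * h (loopD D (bargen k V i y.1) * incl k V a) -
      sgn k p * sgn k (i - 1) * y.2.2 (D.d a)}
  add_mem' := by
    rintro x y ⟨h1, h2⟩ ⟨h3, h4⟩
    refine ⟨?_, fun a ha => ?_⟩
    · simp only [Prod.snd_add, Prod.fst_add, Submodule.coe_add, map_add, smul_add, h1, h3]
      abel
    · simp only [Prod.snd_add, Prod.fst_add, Submodule.coe_add, map_add, add_mul, h2 a ha, h4 a ha,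
        LinearMap.add_apply]
      ring
  zero_mem' := ⟨by simp, fun a _ => by simp⟩
  smul_mem' := by
    rintro c x ⟨h1, h2⟩
    refine ⟨?_, fun a ha => ?_⟩
    · simp only [Prod.smul_snd, Prod.smul_fst, Submodule.coe_smul, map_smul, h1, smul_sub,
        smul_comm c]
    · simp only [Prod.smul_snd, Prod.smul_fst, Submodule.coe_smul, map_smul, smul_mul_assoc,
        h2 a ha, LinearMap.smul_apply, smul_eq_mul]
      ring

variable {D} {p m : ℤ} {θ : Der (wedgePart k V) p} {ε : Wedge k V →ₗ[k] k}
  {g : Loop k V →ₗ[k] k} {F : ∀ i, Submodule k (V i)}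

/-- The relation at `v` sees `η` only through `η (d v)` and `h` only on `d v̄ · a`. Both are
determined by the values over `F` when `d v ∈ ∧ F`, so changes outside `F` do no harm. -/
theorem liftRel_congr {w w' : ∀ i, V i →ₗ[k] LiftValue k V (p - 1) i}
    (hw : ∀ i, ∀ v ∈ F i, w' i v = w i v) {i : ℤ} {v : V i}
    (hv : D.d (wgen k V i v) ∈ subWedge F) {y : LiftValue k V (p - 1) i}
    (h : (v, y) ∈ liftRel D p m θ.1 (liftDer w).1 ε g (liftFunctional w) i) :
    (v, y) ∈ liftRel D p m θ.1 (liftDer w').1 ε g (liftFunctional w') i := by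
  refine ⟨h.1.trans ?_, fun a ha => (h.2 a ha).trans ?_⟩
  · rw [Der.eqOn_subWedge F (liftDer w).2 (liftDer w').2 (fun j x hx => by
      rw [liftDer_wgen, liftDer_wgen, hw j x hx]) hv]
  · rw [liftFunctional, liftFunctional, barFunctional_congr (F := F) (fun j x hx => ?_)
      (loopD_bargen_mul_mem D hv a)]
    rw [LinearMap.comp_apply, LinearMap.comp_apply, hw j x hx]

variable {w : ∀ i, V i →ₗ[k] LiftValue k V (p - 1) i}

theorem liftDer_comm (hw : ∀ i, ∀ v ∈ F i,
      (v, w i v) ∈ liftRel D p m θ.1 (liftDer w).1 ε g (liftFunctional w) i)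
    {x : Wedge k V} (hx : x ∈ subWedge F) :
    D.endDiff (p - 1) (liftDer w).1 x = θ.1 x := by
  have h := D.endDiff_mem (liftDer w).2
  rw [sub_add_cancel] at h
  refine Der.eqOn_subWedge F h θ.2 (fun i v hv => ?_) hx
  rw [DGStructure.endDiff_apply, liftDer_wgen, (hw i v hv).1, sgn_sub, sgn_one]
  module

/-- On the spanning elements `v̄ a` this is the second condition of `liftRel`, and both sides are
linear. It is the inductive hypothesis in the form that can be applied to `d v̄ · b`. -/
theorem apply_contractionEnd_liftDer (hw : ∀ i, ∀ v ∈ F i,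
      (v, w i v) ∈ liftRel D p m θ.1 (liftDer w).1 ε g (liftFunctional w) i)
    {y : Loop k V} (hy : y ∈ barSpanPart F (m - p)) :
    ε (loopProj k V (contractionEnd k V (p - 1) (liftDer w) y)) =
      sgn k p * g y + liftFunctional w (loopD D y) := by
  induction hy using Submodule.span_induction with
  | mem y hy =>
    obtain ⟨i, v, hv, j, a, ha, hij, rfl⟩ := hy
    obtain rfl : j = m - (i + p - 1) := by lia
    have h1 := (hw i v hv).2 a ha
    rw [contractionEnd_bargen_mul, map_smul, loopProj_incl, liftDer_wgen, map_smul, h1,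
      loopD_bargen_mul, map_add, map_smul, liftFunctional_bargen_mul]
    have hs : sgn k p * sgn k p = 1 := sgn_mul_self p
    simp only [sgn_sub, sgn_one, smul_eq_mul]
    linear_combination (liftFunctional w (loopD D (bargen k V i v) * incl k V a) -
      sgn k i * (w i v).2 (D.d a)) * hs
  | zero => simp
  | add x y _ _ hx hy => simp only [map_add, hx, hy, mul_add]; ring
  | smul c x _ hx => simp only [map_smul, hx, smul_eq_mul]; ring

/-- The obstruction to the extension of a lift to a further generator vanishes. -/
theorem exists_mem_liftRel (hPD : D.PoincareDuality m) (hε : D.IsOrientation m ε)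
    (hθ : D.endDiff p θ.1 = 0)
    (hg : ∀ x ∈ loopBarPart k V 1 (m - p - 1),
      ε (loopProj k V (contractionEnd k V p θ x)) = g (loopD D x))
    (hw : ∀ i, ∀ v ∈ F i,
      (v, w i v) ∈ liftRel D p m θ.1 (liftDer w).1 ε g (liftFunctional w) i)
    {i : ℤ} {v : V i} (hv : D.d (wgen k V i v) ∈ subWedge F) :
    ∃ y, (v, y) ∈ liftRel D p m θ.1 (liftDer w).1 ε g (liftFunctional w) i := by
  have hdv := D.d_mem.1 _ _ (wgen_mem i v)
  have hs : sgn k p * sgn k p = 1 := sgn_mul_self p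
  have ht : sgn k i * sgn k i = 1 := sgn_mul_self i
  set η := liftDer w
  set h := liftFunctional w
  set u := wgen k V i v with hu
  have hz : θ.1 u - sgn k p • η.1 (D.d u) ∈ wedgePart k V (i + p) := by
    refine sub_mem (θ.2.1 _ _ (wgen_mem i v)) (Submodule.smul_mem _ _ ?_)
    have := η.2.1 _ _ hdv
    rwa [add_add_sub_cancel] at this
  -- `d v` lies in `∧ F`, where `[d, η] = θ` already holds; so `d η d v = θ d v`, and the cocycle
  -- condition on `θ` gives the claim.
  have hdz : D.d (θ.1 u - sgn k p • η.1 (D.d u)) = 0 := by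
    have h1 := LinearMap.congr_fun hθ u
    have h2 := liftDer_comm hw hv
    rw [DGStructure.endDiff_apply, D.d_d, map_zero, smul_zero, sub_zero] at h2
    rw [map_sub, map_smul, h2]
    exact h1
  -- The functional is the right side of the second condition of `liftRel` without the unknown value
  -- of `h` at `v`. Its compatibility with `z = θ v - (-1)^p η d v` combines `ε ∘ e_θ = g ∘ d` at
  -- `v̄ b` (`e1`) with the inductive hypothesis at `d v̄ · b` (`e2`).
  obtain ⟨x, hx, hxz, ψ, hψ⟩ := hPD.exists_lift hε hz hdz
    (-(g ∘ₗ LinearMap.mulLeft k (bargen k V i v) ∘ₗ (incl k V).toLinearMap) -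
      sgn k p • (h ∘ₗ LinearMap.mulLeft k (loopD D (bargen k V i v)) ∘ₗ (incl k V).toLinearMap))
    (fun b hb => by
      have hbar : loopD D (bargen k V i v) ∈ loopPart k V i := by
        have := (loopD_mem D).1 _ _ (bargen_mem i v)
        rwa [sub_add_cancel] at this
      have hY : loopD D (bargen k V i v) * incl k V b ∈ loopPart k V (m - p) := by
        have := SetLike.mul_mem_graded hbar (incl_mem hb)
        rwa [show i + (m - (i + p)) = m - p by ring] at this
      have e1 := hg _ (bargen_mul_mem_loopBarPart v hb (by ring))
      rw [contractionEnd_bargen_mul, map_smul, loopProj_incl, map_smul, loopD_bargen_mul, map_add,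
        map_smul] at e1
      have e2 := apply_contractionEnd_liftDer hw (mem_barSpanPart (loopD_bargen_mul_mem D hv b) hY)
      -- `e3` holds as `d d v̄ = 0`. `e4` rests on `d v̄ = - s d v` and on `e_η s = ± η` on `∧ V`.
      have e3 : loopD D (loopD D (bargen k V i v) * incl k V b) =
          sgn k i • (loopD D (bargen k V i v) * incl k V (D.d b)) := by
        rw [(loopD_mem D).2 _ _ hbar, loopD_incl, one_mul,
          show loopD D (loopD D (bargen k V i v)) = 0 from (loopDG D).d_d _, zero_mul, zero_add]
      have e4 : loopProj k V (contractionEnd k V (p - 1) η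
          (loopD D (bargen k V i v) * incl k V b)) = sgn k p • (η.1 (D.d u) * b) := by
        rw [(contractionEnd_mem _ η).2 _ _ hbar, contractionEnd_incl, mul_zero, smul_zero, add_zero,
          loopD_bargen, map_neg, contractionEnd_loopS_incl, ← smul_neg, smul_mul_assoc, map_smul,
          map_mul, map_neg, loopProj_incl, loopProj_incl, sgn_sub, sgn_one]
        simp [hu]
      rw [e4, e3, map_smul, map_smul] at e2
      simp only [LinearMap.sub_apply, LinearMap.neg_apply, LinearMap.comp_apply,
        LinearMap.mulLeft_apply, LinearMap.smul_apply, AlgHom.toLinearMap_apply, smul_eq_mul,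
        sub_mul, map_sub, smul_mul_assoc, map_smul, sgn_add, sgn_sub, sgn_one] at e1 e2 ⊢
      linear_combination -sgn k i * e1 + sgn k i * sgn k p * e2 +
        (g (bargen k V i v * incl k V (D.d b)) +
          sgn k p * h (loopD D (bargen k V i v) * incl k V (D.d b))) * ht +
        sgn k i * g (loopD D (bargen k V i v) * incl k V b) * hs)
  -- The factor on `ψ` cancels the sign in front of `y.2.2` in `liftRel`, leaving `- ψ (d a)`.
  refine ⟨(⟨x, by rwa [← add_sub_assoc]⟩, (sgn k p * sgn k (i - 1)) • ψ), hxz, fun a ha => ?_⟩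
  have h1 := hψ a ha
  have hi : sgn k (i - 1) * sgn k (i - 1) = 1 := sgn_mul_self _
  simp only [LinearMap.sub_apply, LinearMap.neg_apply, LinearMap.comp_apply,
    LinearMap.mulLeft_apply, LinearMap.smul_apply, AlgHom.toLinearMap_apply, smul_eq_mul] at h1 ⊢
  linear_combination -h1 + ψ (D.d a) * sgn k p * sgn k p * hi + ψ (D.d a) * hs

/-- A lift over `∧ F` extends to `∧ F'` if `d F' ⊆ ∧ F`. -/
theorem exists_lift_extension (hPD : D.PoincareDuality m) (hε : D.IsOrientation m ε)
    (hθ : D.endDiff p θ.1 = 0)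
    (hg : ∀ x ∈ loopBarPart k V 1 (m - p - 1),
      ε (loopProj k V (contractionEnd k V p θ x)) = g (loopD D x))
    (hw : ∀ i, ∀ v ∈ F i,
      (v, w i v) ∈ liftRel D p m θ.1 (liftDer w).1 ε g (liftFunctional w) i)
    {F' : ∀ i, Submodule k (V i)} (hF : ∀ i, F i ≤ F' i)
    (hd : ∀ i, ∀ v ∈ F' i, D.d (wgen k V i v) ∈ subWedge F) :
    ∃ w' : ∀ i, V i →ₗ[k] LiftValue k V (p - 1) i, (∀ i, ∀ v ∈ F i, w' i v = w i v) ∧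
      ∀ i, ∀ v ∈ F' i,
        (v, w' i v) ∈ liftRel D p m θ.1 (liftDer w').1 ε g (liftFunctional w') i := by
  -- The new values are chosen against the old `η` and `h`; `liftRel_congr` then replaces these by
  -- the ones built from `w'`.
  choose w' h1 h2 using fun i => exists_linearMap_graph _ (hF i) (w i) (hw i)
    (fun v hv => exists_mem_liftRel hPD hε hθ hg hw (hd i v hv))
  exact ⟨w', h1, fun i v hv => liftRel_congr h1 (hd i v hv) (h2 i v hv)⟩

/-- If the functional `ε ∘ e_θ` on the cocycles of `𝓛_(1)` vanishes, then `θ` is a coboundary. -/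
theorem mem_derCoboundaries_of_forall_eq_zero (hD : IsSimplyConnectedSullivan D)
    (hPD : D.PoincareDuality m) (hε : D.IsOrientation m ε) (hθ : D.endDiff p θ.1 = 0)
    (h0 : ∀ x ∈ loopBarPart k V 1 (m - p - 1), loopD D x = 0 →
      ε (loopProj k V (contractionEnd k V p θ x)) = 0) :
    θ.1 ∈ D.derCoboundaries p := by
  obtain ⟨g, hg⟩ := exists_dual_comp_eq (loopBarPart k V 1 (m - p - 1)) (loopD D)
    (ε ∘ₗ (loopProj k V).toLinearMap ∘ₗ contractionEnd k V p θ) h0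
  obtain ⟨F, hmono, hex, hF0, hF⟩ := hD.exists_filtration
  -- Putting `⊥` below the filtration makes the stage `d = 0` on `F 0` an instance of the general
  -- step, starting from the zero lift.
  let G : ℕ → ∀ i, Submodule k (V i) := fun n => n.casesOn (fun _ => ⊥) F
  have hG (i) : Monotone fun n => G n i := monotone_nat_of_le_succ fun n => by
    cases n with
    | zero => exact bot_le
    | succ n => exact hmono n i
  have hGd (n i) (v) (hv : v ∈ G (n + 1) i) : D.d (wgen k V i v) ∈ subWedge (G n) := by
    cases n with
    | zero => rw [hF0 i v hv]; exact zero_mem _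
    | succ n => exact hF n i v hv
  let Good (n : ℕ) (w : ∀ i, V i →ₗ[k] LiftValue k V (p - 1) i) : Prop := ∀ i, ∀ v ∈ G n i,
    (v, w i v) ∈ liftRel D p m θ.1 (liftDer w).1 ε g (liftFunctional w) i
  have hstep (n : ℕ) (w : {w // Good n w}) : ∃ w' : {w // Good (n + 1) w},
      ∀ i, ∀ v ∈ G n i, w'.1 i v = w.1 i v := by
    obtain ⟨w', h1, h2⟩ := exists_lift_extension hPD hε hθ hg w.2
      (fun i => hG i n.le_succ) (hGd n)
    exact ⟨⟨w', h2⟩, h1⟩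
  choose next hnext using hstep
  let W : ∀ n, {w // Good n w} := fun n => n.rec ⟨fun _ => 0, fun i v hv => by
    rw [show v = 0 from hv]
    exact zero_mem _⟩ next
  choose w hw using fun i => exists_linearMap_of_chain (fun n => G n i) (hG i)
    (fun v => (hex i v).imp' Nat.succ fun _ h => h) (fun n => (W n).1 i)
    (fun n v hv => hnext n (W n) i v hv)
  have hrel (i : ℤ) (v : V i) :
      (v, w i v) ∈ liftRel D p m θ.1 (liftDer w).1 ε g (liftFunctional w) i := by
    obtain ⟨n, hn⟩ := hex i v
    have hn' : v ∈ G (n + 1) i := hn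
    -- For `v` in stage `n + 1` the relation involves only stage `n` besides the value at `v`, and
    -- there the limit agrees with the lift `W (n + 1)`.
    refine liftRel_congr (F := G n) (w := (W (n + 1)).1)
      (fun j x hx => hw j (n + 1) x (hG j n.le_succ hx)) (hGd n i v hn) ?_
    rw [hw i (n + 1) v hn']
    exact (W (n + 1)).2 i v hn'
  refine ⟨(liftDer w).1, (liftDer w).2, LinearMap.ext fun x => ?_⟩
  refine liftDer_comm (F := fun _ => ⊤) (fun i v _ => hrel i v) ?_
  induction x using FreeGCA.induction with
  | one => exact one_mem _
  | gen_mul i v x hx => exact mul_mem (Algebra.subset_adjoin ⟨i, v, trivial, rfl⟩) hx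
  | add x y hx hy => exact add_mem hx hy
  | smul c x hx => exact Subalgebra.smul_mem _ hx c

end Lifting

/-! ### From functionals to classes: surjecting onto `ω` and injectivity -/

section Main

variable {k : Type u} [Field k] {V : ℤ → Type v} [∀ i, AddCommGroup (V i)] [∀ i, Module k (V i)]
  {D : DGStructure (wedgePart k V)} {m : ℤ}

theorem inclCohomology_cls {z : Wedge k V} (hz : D.d z = 0)
    (hz' : loopD D (incl k V z) = 0) :
    inclCohomology D (D.cls ⟨z, hz⟩) = (loopDG D).cls ⟨incl k V z, hz'⟩ := rfl

theorem loopProj_loopS_incl (a : Wedge k V) : loopProj k V (loopS k V (incl k V a)) = 0 := by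
  induction a using FreeGCA.induction with
  | one => rw [map_one, Der.map_one loopS_mem, map_zero]
  | gen_mul i v x hx =>
    rw [map_mul, incl_gen, loopS_mem.2 _ _ (vgen_mem i v), loopS_vgen, map_add, map_smul, map_mul,
      map_mul, hx, loopProj_bargen, zero_mul, mul_zero, smul_zero, add_zero]
  | add x y hx hy => rw [map_add, map_add, map_add, hx, hy, add_zero]
  | smul c x hx => rw [map_smul, map_smul, map_smul, hx, smul_zero]

/-- The ideal generated by `V̄` is stable under `d`, because `d v̄ = - s d v` lies in it. Hence
`loopProj` is a chain map, and being a retraction of the inclusion it makes `H(∧ V) → H(𝓛)`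
injective. -/
theorem loopProj_loopD (a : Loop k V) : loopProj k V (loopD D a) = D.d (loopProj k V a) := by
  induction a using FreeGCA.induction with
  | one => rw [Der.map_one (loopD_mem D), map_zero, map_one, Der.map_one D.d_mem]
  | gen_mul x v a ha =>
    obtain ⟨i, _ | _⟩ := x
    · rw [(loopD_mem D).2 _ _ (vgen_mem i v), loopD_vgen, map_add, map_smul, map_mul, map_mul, ha,
        map_mul, ← incl_gen, loopProj_incl, loopProj_incl, D.d_mem.2 _ _ (wgen_mem i v)]
    · rw [(loopD_mem D).2 _ _ (bargen_mem i v), loopD_bargen, map_add, map_smul, map_mul, map_mul,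
        map_mul, map_neg, loopProj_loopS_incl, loopProj_bargen]
      simp
  | add x y hx hy => simp only [map_add, hx, hy]
  | smul c x hx => simp only [map_smul, hx]

theorem inclCohomology_injective : Function.Injective (inclCohomology D) := by
  rw [injective_iff_map_eq_zero]
  intro x hx
  obtain ⟨z, rfl⟩ := D.cls_surjective x
  obtain ⟨a, ha⟩ := (loopDG D).cls_eq_zero_iff.1 hx
  refine D.cls_eq_zero_iff.2 ⟨loopProj k V a, ?_⟩
  rw [← loopProj_loopD, show loopD D a = incl k V z from ha, loopProj_incl]

theorem exists_contractionInduced_eq (hD : IsSimplyConnectedSullivan D)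
    (hPD : D.PoincareDuality m) {ω : D.Cohomology} (hω : ω ∈ D.cohomologyPart m)
    {p : ℤ} {θ : D.DerCohomology p} (hθ : θ ≠ 0) :
    ∃ α ∈ loopBarCohomology D 1 (m - p - 1),
      (contractionInduced D p θ).1 α = inclCohomology D ω := by
  obtain ⟨θ, rfl⟩ := Submodule.Quotient.mk_surjective _ θ
  obtain ⟨ε, hε⟩ := hPD.exists_orientation
  let θ' : Der (wedgePart k V) p := ⟨θ.1, θ.2.1⟩
  -- As `θ` is not a coboundary, `ε ∘ e_θ` is nonzero on some cocycle `x` of `𝓛_(1)`.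
  have hne : ¬ ∀ x ∈ loopBarPart k V 1 (m - p - 1), loopD D x = 0 →
      ε (loopProj k V (contractionEnd k V p θ' x)) = 0 := fun h => hθ
    ((Submodule.Quotient.mk_eq_zero _).2
      (mem_derCoboundaries_of_forall_eq_zero (θ := θ') hD hPD hε θ.2.2 h))
  push Not at hne
  obtain ⟨x, hx, hdx, hx0⟩ := hne
  have hincl := (contractionEnd_barWeight p θ' hx.2).2 rfl
  set c := loopProj k V (contractionEnd k V p θ' x) with hc
  have hcm : c ∈ wedgePart k V m := by
    have := loopProj_mem ((contractionEnd_mem p θ').1 _ _ hx.1)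
    rwa [sub_add_add_cancel, sub_add_cancel] at this
  have hex : loopD D (contractionEnd k V p θ' x) = 0 :=
    (loopDG D).inducedEnd_cocycle (contractionCocycle D p θ) ⟨x, hdx⟩
  have hdc : D.d c = 0 := by
    rw [← loopProj_incl (D.d c), ← loopD_incl, hincl, hex, map_zero]
  -- `ε` kills coboundaries but not `c`. As `H^m` is a line, `ω` is then a multiple of the class of
  -- `c`, and the same multiple of `x` gives `α`.
  have hc0 : D.cls ⟨c, hdc⟩ ≠ 0 := fun h => by
    obtain ⟨a, ha⟩ := D.cls_eq_zero_iff.1 h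
    apply hx0
    rw [show c = D.d a from ha.symm, hε.map_d]
  obtain ⟨r, hr⟩ := hPD.exists_smul_eq (D.cls_mem_cohomologyPart hcm hdc) hc0 hω
  refine ⟨r • (loopDG D).cls ⟨x, hdx⟩, Submodule.smul_mem _ r ⟨⟨x, hdx⟩, hx, rfl⟩, ?_⟩
  rw [← hr, map_smul, map_smul, inclCohomology_cls hdc (by rw [hincl, hex])]
  refine congrArg (r • ·) ?_
  exact (loopDG D).inducedEnd_cls (contractionCocycle D p θ) ⟨x, hdx⟩ hincl _

set_option synthInstance.maxHeartbeats 400000 in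
theorem contractionInduced_injective (hD : IsSimplyConnectedSullivan D)
    (hPD : D.PoincareDuality m) (p : ℤ) : Function.Injective (contractionInduced D p) := by
  rw [injective_iff_map_eq_zero]
  intro θ hθ
  by_contra h
  -- If `H(e_θ) = 0` with `[θ] ≠ 0`, a fundamental class would become zero in `H(𝓛)`, against
  -- `inclCohomology_injective`.
  obtain ⟨ω, hω, h0⟩ := hPD.exists_ne_zero
  obtain ⟨α, -, hα⟩ := exists_contractionInduced_eq hD hPD hω h
  rw [hθ] at hα
  exact h0 (inclCohomology_injective (hα.symm.trans (map_zero _).symm))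

end Main

end SullivanLoop
end

theorem theorem3p5 {k : Type*} [Field k] [CharZero k]
    (V : ℤ → Type*) [∀ i, AddCommGroup (V i)] [∀ i, Module k (V i)]
    (D : SullivanLoop.DGStructure (SullivanLoop.wedgePart k V))
    (hD : SullivanLoop.IsSimplyConnectedSullivan D)
    (m : ℤ) (hPD : D.PoincareDuality m) :
    (∀ ω ∈ D.cohomologyPart m, ω ≠ 0 →
      ∀ (n : ℤ) (θ : D.DerCohomology (-n - 1)), θ ≠ 0 →
        ∃ α ∈ SullivanLoop.loopBarCohomology D 1 (m + n),
          (SullivanLoop.contractionInduced D (-n - 1) θ).1 α =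
            SullivanLoop.inclCohomology D ω) ∧
    (∀ p : ℤ, Function.Injective (SullivanLoop.contractionInduced D p)) ∧
    (∀ p : ℤ, Function.Injective (SullivanLoop.contractionCohomology D p)) := by
  refine ⟨fun ω hω _ n θ hθ => ?_, SullivanLoop.contractionInduced_injective hD hPD, fun p =>
    -- `contractionInduced` factors through `contractionCohomology`, so its injectivity passes to
    -- the first factor.
    Function.Injective.of_comp (f := (SullivanLoop.loopDG D).inducedDer (p + 1))
      (SullivanLoop.contractionInduced_injective hD hPD p)⟩
  have h := SullivanLoop.exists_contractionInduced_eq hD hPD hω hθ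
  rwa [show m - (-n - 1) - 1 = m + n by ring] at h
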